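/- Fix $m_0>0$. On the half plane $\rho>0$, $z\in\mathbb R$, put $r=\sqrt{\rho^2+z^2}$, $\rho=r\sin\theta$, $z=r\cos\theta$, $\Sigma=(r+m_0)^2+m_0^2\cos^2\theta$, and let $$\eta_0=\frac{\big((r+m_0)^2+m_0^2\big)^2-r^2m_0^2\sin^2\theta}{\Sigma}\sin^2\theta,\qquad \omega_0=2m_0^2(\cos^3\theta-3\cos\theta)-\frac{2m_0^4\cos\theta\sin^4\theta}{\Sigma},$$ $$e^{\sigma_0}=\frac{\eta_0}{\rho^2},\qquad e^{2q_0}=\frac{\Sigma\sin^2\theta}{\eta_0},\qquad u_0=\ln\rho+\sigma_0+q_0$$ be the norm and twist potential of the axial Killing vector and the metric functions of the extreme Kerr black hole of mass $m_0$ (the horizon is the point $r=0$). Write $\partial f\,\partial g=\partial_\rho f\,\partial_\rho g+\partial_z f\,\partial_z g$, $\Delta f=\partial_\rho^2f+\partial_z^2f$, ${}^{(3)}\!\Delta f=\Delta f+\rho^{-1}\partial_\rho f$, ${}^{(7)}\!\Delta f=\Delta f+5\rho^{-1}\partial_\rho f$; a dot is $\partial_t$. Let $\sigma_1,\omega_1$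 and the shift vector $\beta_1=(\beta_1^\rho,\beta_1^z)$ be $C^2$ functions of $(t,\rho,z)$, for $t$ in an open set of times and $\rho>0$, which satisfy the linearized evolution equations in the maximal-isothermal gauge $$-e^{2(\sigma_0+q_0)}\dot p+{}^{(3)}\!\Delta\sigma_1=\frac{2}{\eta_0^2}\big(\sigma_1|\partial\omega_0|^2-\partial\omega_1\,\partial\omega_0\big),$$ $$-e^{2(\sigma_0+q_0)}\dot d+{}^{(3)}\!\Delta\omega_1=\frac{4\,\partial_\rho\omega_1}{\rho}+2\,\partial\omega_1\,\partial\sigma_0+2\,\partial\omega_0\,\partial\sigma_1,$$ where $p=\dot\sigma_1-2\beta_1^\rho/\rho-\beta_1^A\partial_A\sigma_0$ and $d=\dot\omega_1-\beta_1^A\partial_A\omega_0$. Assume that, at each time, $\omega_1\to0$ at every point $(0,z)$, $z\ne0$, of the axis, and that $\sigma_1\to0$ and $\omega_1/r^2\to0$ as $r\to\infty$. (Nothing is assumed at the horizon, and the remaining linearized Einstein equations are not needed.) Let $\chi_{1AB}=\frac{e^{2u_0}}{2\rho}\big(\partial_A\beta_{1B}+\partial_B\beta_{1A}-\delta_{AB}\,\partial_C\beta_1^C\big)$,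 with indices moved by $\delta_{AB}$, let $\bar\omega_1=\omega_1/\eta_0^2$, and let $$\frac{\varepsilon_2}{\rho}=2e^{2(\sigma_0+q_0)}p^2+\frac{2e^{2(\sigma_0+q_0)}}{\eta_0^2}d^2+4e^{-2u_0}\chi_1^{AB}\chi_{1AB}+\Big|\partial\sigma_1+\frac{\omega_1}{\eta_0^2}\partial\omega_0\Big|^2+\Big|\partial\Big(\frac{\omega_1}{\eta_0}\Big)-\frac{\sigma_1}{\eta_0}\partial\omega_0\Big|^2+\Big|\frac{\sigma_1}{\eta_0}\partial\omega_0-\frac{\omega_1}{\eta_0^2}\partial\eta_0\Big|^2 .$$ Let $m_2=\frac1{16}\int\varepsilon_2\,d\rho\,dz\in[0,\infty]$ be the second-order mass at time $t$, and let $\bar m_2$ be the same integral with $p,d,\chi_1,\sigma_1,\omega_1$ replaced by $\dot p,\dot d,\dot\chi_1,\dot\sigma_1,\dot\omega_1$. **Theorem.** There is a constant $C>0$ depending only on $m_0$ such that, for all such perturbations and at every time, $$\int_{\rho>0}\Big(\tfrac12\eta_0^2|\partial\bar\omega_1|^2+|\partial\eta_0|^2\bar\omega_1^2+|\partial\sigma_1|^2+\frac{\sigma_1^2}{r^2}\Big)\rho\,d\rho\,dz\le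 C\,m_2,$$ $$\int_{\rho>0}\Big(\big({}^{(3)}\!\Delta\sigma_1\big)^2+\eta_0^2\big({}^{(7)}\!\Delta\bar\omega_1\big)^2\Big)e^{-2(q_0+\sigma_0)}\rho\,d\rho\,dz\le C\,(\bar m_2+m_2).$$ -/

import Mathlib

open Set Filter Topology MeasureTheory
open scoped ENNReal

noncomputable section

namespace ExtremeKerr

/-! Functions on the half plane are functions of `(ρ, z)`, used for `ρ > 0`; fields depending on
time are functions of `(t, ρ, z)`. -/

/-- The half plane `ρ > 0` (the axis `ρ = 0` is a null set). -/
def halfPlane : Set (ℝ × ℝ) := {x | 0 < x.1}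

/-- `∂_ρ f`. -/
def dRho (f : ℝ → ℝ → ℝ) (ρ z : ℝ) : ℝ := deriv (fun s => f s z) ρ

/-- `∂_z f`. -/
def dZ (f : ℝ → ℝ → ℝ) (ρ z : ℝ) : ℝ := deriv (fun s => f ρ s) z

/-- The time derivative. -/
def dot (f : ℝ → ℝ → ℝ → ℝ) (t ρ z : ℝ) : ℝ := deriv (fun s => f s ρ z) t

/-- `∂f ∂g = ∂_ρ f ∂_ρ g + ∂_z f ∂_z g`. -/
def gradDot (f g : ℝ → ℝ → ℝ) (ρ z : ℝ) : ℝ := dRho f ρ z * dRho g ρ z + dZ f ρ z * dZ g ρ z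

/-- `|∂f|²`. -/
def gradSq (f : ℝ → ℝ → ℝ) (ρ z : ℝ) : ℝ := dRho f ρ z ^ 2 + dZ f ρ z ^ 2

/-- The flat two-dimensional Laplacian `∂_ρ² f + ∂_z² f`. -/
def lap2 (f : ℝ → ℝ → ℝ) (ρ z : ℝ) : ℝ := dRho (dRho f) ρ z + dZ (dZ f) ρ z

/-- `³Δ f = Δ f + ∂_ρ f / ρ`. -/
def lap3 (f : ℝ → ℝ → ℝ) (ρ z : ℝ) : ℝ := lap2 f ρ z + dRho f ρ z / ρ

/-- `⁷Δ f = Δ f + 5 ∂_ρ f / ρ`. -/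
def lap7 (f : ℝ → ℝ → ℝ) (ρ z : ℝ) : ℝ := lap2 f ρ z + 5 * (dRho f ρ z / ρ)

/-! ### The extreme Kerr background of mass `m` (angular momentum `m²`)

Here `r` is the isotropic radius, `ρ = r sin θ`, `z = r cos θ`, and the Boyer-Lindquist radius
is `r + m`. -/

/-- `r = √(ρ² + z²)`. -/
def rad (ρ z : ℝ) : ℝ := Real.sqrt (ρ ^ 2 + z ^ 2)

def sinTheta (ρ z : ℝ) : ℝ := ρ / rad ρ z

def cosTheta (ρ z : ℝ) : ℝ := z / rad ρ z

/-- `Σ = (r + m)² + m² cos² θ`. -/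
def kerrSigma (m ρ z : ℝ) : ℝ := (rad ρ z + m) ^ 2 + m ^ 2 * cosTheta ρ z ^ 2

/-- The square norm `η₀` of the axial Killing vector. -/
def eta0 (m ρ z : ℝ) : ℝ :=
  (((rad ρ z + m) ^ 2 + m ^ 2) ^ 2 - rad ρ z ^ 2 * m ^ 2 * sinTheta ρ z ^ 2) / kerrSigma m ρ z
    * sinTheta ρ z ^ 2

/-- The twist potential `ω₀` of the axial Killing vector. -/
def omega0 (m ρ z : ℝ) : ℝ :=
  2 * m ^ 2 * (cosTheta ρ z ^ 3 - 3 * cosTheta ρ z)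
    - 2 * m ^ 4 * cosTheta ρ z * sinTheta ρ z ^ 4 / kerrSigma m ρ z

/-- `σ₀`, defined by `e^{σ₀} = η₀ / ρ²`. -/
def sigma0 (m ρ z : ℝ) : ℝ := Real.log (eta0 m ρ z / ρ ^ 2)

/-- `q₀`, defined by `e^{2 q₀} = Σ sin² θ / η₀`: the metric of the slices `t = const` is
`e^{σ₀ + 2 q₀} (dρ² + dz²) + ρ² e^{σ₀} dφ²`. -/
def q0 (m ρ z : ℝ) : ℝ := Real.log (kerrSigma m ρ z * sinTheta ρ z ^ 2 / eta0 m ρ z) / 2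

/-- `u₀ = log ρ + σ₀ + q₀`: the rescaled quotient metric of the slices is
`e^{2 u₀} (dρ² + dz²)`. The background lapse is `ρ`. -/
def u0 (m ρ z : ℝ) : ℝ := Real.log ρ + sigma0 m ρ z + q0 m ρ z

/-! ### Linear perturbations -/

/-- The first order quantities: the perturbations `σ₁`, `ω₁` of the norm and of the twist of the
axial Killing vector, and the shift vector `β₁ = (β₁^ρ, β₁^z)`, as functions of `(t, ρ, z)`. -/
structure Perturbation where
  σ : ℝ → ℝ → ℝ → ℝ
  ω : ℝ → ℝ → ℝ → ℝ
  βρ : ℝ → ℝ → ℝ → ℝ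
  βz : ℝ → ℝ → ℝ → ℝ

namespace Perturbation

/-- `ω̄₁ = ω₁ / η₀²`. -/
def omegaBar (m : ℝ) (P : Perturbation) (t ρ z : ℝ) : ℝ := P.ω t ρ z / eta0 m ρ z ^ 2

/-- `p = ∂_t σ₁ - 2 β₁^ρ / ρ - β₁^A ∂_A σ₀`. -/
def p (m : ℝ) (P : Perturbation) (t ρ z : ℝ) : ℝ :=
  dot P.σ t ρ z - 2 * (P.βρ t ρ z / ρ)
    - (P.βρ t ρ z * dRho (sigma0 m) ρ z + P.βz t ρ z * dZ (sigma0 m) ρ z)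

/-- `d = ∂_t ω₁ - β₁^A ∂_A ω₀`. -/
def d (m : ℝ) (P : Perturbation) (t ρ z : ℝ) : ℝ :=
  dot P.ω t ρ z - (P.βρ t ρ z * dRho (omega0 m) ρ z + P.βz t ρ z * dZ (omega0 m) ρ z)

/-- The component `χ₁_{ρρ}` of the trace-free second fundamental form. In the maximal-isothermal
gauge `∂_A β₁_B + ∂_B β₁_A - δ_{AB} ∂_C β₁^C = 2 ρ e^{-2 u₀} χ₁_{AB}`. -/
def chiRhoRho (m : ℝ) (P : Perturbation) (t ρ z : ℝ) : ℝ :=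
  Real.exp (2 * u0 m ρ z) / (2 * ρ) * (dRho (P.βρ t) ρ z - dZ (P.βz t) ρ z)

/-- The component `χ₁_{ρz}`; see `chiRhoRho`. The remaining one is `χ₁_{zz} = -χ₁_{ρρ}`. -/
def chiRhoZ (m : ℝ) (P : Perturbation) (t ρ z : ℝ) : ℝ :=
  Real.exp (2 * u0 m ρ z) / (2 * ρ) * (dRho (P.βz t) ρ z + dZ (P.βρ t) ρ z)

end Perturbation

/-- Axially symmetric linear perturbations of the extreme Kerr black hole of mass `m` in the
maximal-isothermal gauge, for times in the open set `I`. The remaining linearized equations (for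
the metric function `q₁` and for `χ₁`, and the constraints) only restrict this class further and
are not imposed. No condition is imposed at the horizon `r = 0`. -/
structure IsLinearPerturbation (m : ℝ) (I : Set ℝ) (P : Perturbation) : Prop where
  isOpen : IsOpen I
  smooth_σ : ContDiffOn ℝ 2 (fun x : ℝ × ℝ × ℝ => P.σ x.1 x.2.1 x.2.2) (I ×ˢ halfPlane)
  smooth_ω : ContDiffOn ℝ 2 (fun x : ℝ × ℝ × ℝ => P.ω x.1 x.2.1 x.2.2) (I ×ˢ halfPlane)
  smooth_βρ : ContDiffOn ℝ 2 (fun x : ℝ × ℝ × ℝ => P.βρ x.1 x.2.1 x.2.2) (I ×ˢ halfPlane)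
  smooth_βz : ContDiffOn ℝ 2 (fun x : ℝ × ℝ × ℝ => P.βz x.1 x.2.1 x.2.2) (I ×ˢ halfPlane)
  /-- The evolution equation for `σ₁`. -/
  evolution_σ : ∀ t ∈ I, ∀ ρ z : ℝ, 0 < ρ →
    -Real.exp (2 * (sigma0 m ρ z + q0 m ρ z)) * dot (P.p m) t ρ z + lap3 (P.σ t) ρ z
      = 2 / eta0 m ρ z ^ 2
        * (P.σ t ρ z * gradSq (omega0 m) ρ z - gradDot (P.ω t) (omega0 m) ρ z)
  /-- The evolution equation for `ω₁`. -/
  evolution_ω : ∀ t ∈ I, ∀ ρ z : ℝ, 0 < ρ →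
    -Real.exp (2 * (sigma0 m ρ z + q0 m ρ z)) * dot (P.d m) t ρ z + lap3 (P.ω t) ρ z
      = 4 * (dRho (P.ω t) ρ z / ρ) + 2 * gradDot (P.ω t) (sigma0 m) ρ z
        + 2 * gradDot (omega0 m) (P.σ t) ρ z
  /-- `ω₁` vanishes at the axis: the angular momentum is not perturbed. -/
  axis_ω : ∀ t ∈ I, ∀ z : ℝ, z ≠ 0 →
    Tendsto (fun x : ℝ × ℝ => P.ω t x.1 x.2) (𝓝[halfPlane] (0, z)) (𝓝 0)
  /-- `σ₁ → 0` at infinity. -/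
  falloff_σ : ∀ t ∈ I,
    Tendsto (fun x : ℝ × ℝ => P.σ t x.1 x.2) (cocompact (ℝ × ℝ) ⊓ 𝓟 halfPlane) (𝓝 0)
  /-- `ω₁ = o(r²)` at infinity. -/
  falloff_ω : ∀ t ∈ I,
    Tendsto (fun x : ℝ × ℝ => P.ω t x.1 x.2 / rad x.1 x.2 ^ 2)
      (cocompact (ℝ × ℝ) ⊓ 𝓟 halfPlane) (𝓝 0)

/-- The energy density as a quadratic form in `p`, `d`, `χ_{ρρ}`, `χ_{ρz}`, `σ`, `ω` (at a fixed
time). Here `χ^{AB} χ_{AB} = 2 (χ_{ρρ}² + χ_{ρz}²)`, the indices being raised with the flat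
metric, and the squares of vectors are sums over the components `ρ`, `z`. -/
def energyDensity (m : ℝ) (p d χρρ χρz σ ω : ℝ → ℝ → ℝ) (ρ z : ℝ) : ℝ :=
  ρ * (2 * Real.exp (2 * (sigma0 m ρ z + q0 m ρ z)) * p ρ z ^ 2
    + 2 * (Real.exp (2 * (sigma0 m ρ z + q0 m ρ z)) / eta0 m ρ z ^ 2) * d ρ z ^ 2
    + 4 * Real.exp (-2 * u0 m ρ z) * (2 * (χρρ ρ z ^ 2 + χρz ρ z ^ 2))
    + ((dRho σ ρ z + ω ρ z / eta0 m ρ z ^ 2 * dRho (omega0 m) ρ z) ^ 2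
      + (dZ σ ρ z + ω ρ z / eta0 m ρ z ^ 2 * dZ (omega0 m) ρ z) ^ 2)
    + ((dRho (fun a b => ω a b / eta0 m a b) ρ z
          - σ ρ z / eta0 m ρ z * dRho (omega0 m) ρ z) ^ 2
      + (dZ (fun a b => ω a b / eta0 m a b) ρ z
          - σ ρ z / eta0 m ρ z * dZ (omega0 m) ρ z) ^ 2)
    + ((σ ρ z / eta0 m ρ z * dRho (omega0 m) ρ z
          - ω ρ z / eta0 m ρ z ^ 2 * dRho (eta0 m) ρ z) ^ 2
      + (σ ρ z / eta0 m ρ z * dZ (omega0 m) ρ z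
          - ω ρ z / eta0 m ρ z ^ 2 * dZ (eta0 m) ρ z) ^ 2))

/-- The second order mass `m₂ = (1/16) ∫ ε₂ dρ dz` at time `t`, with values in `[0, ∞]`. -/
def mass2 (m : ℝ) (P : Perturbation) (t : ℝ) : ℝ≥0∞ :=
  (∫⁻ x in halfPlane, ENNReal.ofReal
    (energyDensity m (P.p m t) (P.d m t) (P.chiRhoRho m t) (P.chiRhoZ m t) (P.σ t) (P.ω t)
      x.1 x.2)) / 16

/-- The higher order mass `m̄₂` at time `t`: the same integral for the time derivatives of all
perturbation quantities. -/
def mass2Bar (m : ℝ) (P : Perturbation) (t : ℝ) : ℝ≥0∞ :=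
  (∫⁻ x in halfPlane, ENNReal.ofReal
    (energyDensity m (dot (P.p m) t) (dot (P.d m) t) (dot (P.chiRhoRho m) t)
      (dot (P.chiRhoZ m) t) (dot P.σ t) (dot P.ω t) x.1 x.2)) / 16

/-- The weighted integral of first order quantities, with the measure `ρ dρ dz`. -/
def firstOrderIntegral (m : ℝ) (P : Perturbation) (t : ℝ) : ℝ≥0∞ :=
  ∫⁻ x in halfPlane, ENNReal.ofReal
    ((1 / 2 * eta0 m x.1 x.2 ^ 2 * gradSq (P.omegaBar m t) x.1 x.2
      + gradSq (eta0 m) x.1 x.2 * P.omegaBar m t x.1 x.2 ^ 2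
      + gradSq (P.σ t) x.1 x.2
      + P.σ t x.1 x.2 ^ 2 / rad x.1 x.2 ^ 2) * x.1)

/-- The weighted integral of second order quantities, with the measure `ρ dρ dz`. -/
def secondOrderIntegral (m : ℝ) (P : Perturbation) (t : ℝ) : ℝ≥0∞ :=
  ∫⁻ x in halfPlane, ENNReal.ofReal
    ((lap3 (P.σ t) x.1 x.2 ^ 2 + eta0 m x.1 x.2 ^ 2 * lap7 (P.omegaBar m t) x.1 x.2 ^ 2)
      * Real.exp (-2 * (q0 m x.1 x.2 + sigma0 m x.1 x.2)) * x.1)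

end ExtremeKerr

end

/-! Write `b = ω₁ / η₀²`. Besides kinetic terms the energy density contains the squares of X = ∂σ₁ +
b ∂ω₀, Y = ∂(ω₁/η₀) − (σ₁/η₀) ∂ω₀ and Z = (σ₁/η₀) ∂ω₀ − b ∂η₀. The decisive point is that σ₁ cancels
in the sum: Y + Z = η₀ ∂b. Hence the energy alone controls η₀² |∂b|² (`eta0_sq_mul_gradSq_le`). As
η₀ is comparable to (r + m)² sin²θ, this is a weighted Dirichlet integral of b with weight (r + m)⁴
sin⁴θ. Hardy's inequality along rays (`hardy_halfPlane_radial`) bounds b²/r² with the same weight,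
and Hardy's inequality along circles (`hardy_halfPlane_angular`) improves sin⁴θ to sin²θ near the
axis, which is what |∂η₀|² b² requires. Now X gives ∂σ₁, because |∂ω₀| ≲ η₀ / r makes b ∂ω₀ a
controlled term, and a last radial Hardy inequality gives σ₁ / r. This is `exists_coercivity`. In
both Hardy inequalities the boundary terms at the horizon and at the axis have the favourable sign
and are dropped; only decay as r → ∞ along each ray enters.

For the second estimate the evolution equations are solved for ³Δσ₁ and, after conjugation by η₀² =
ρ⁴ exp(2σ₀), for ⁷Δb (`lap7_div_eta0_sq`). The squares of the terms with time derivatives, times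
exp(−2(q₀ + σ₀)), are exactly kinetic terms of m̄₂. All other terms are of lower order; compared
with the weighted norm their coefficients lose one factor 1/r, and the weight, at most r²/m², makes
up for it (`laplacian_sq_le`). So they are bounded by the first estimate.

The background enters only through scale-invariant bounds on η₀, ω₀, σ₀ and their derivatives
(`exists_background_bound`), obtained from a calculus of jets instead of explicit differentiation.
-/

namespace ExtremeKerr

/-! ### Calculus of scale-invariant jet bounds in one variable -/

/-- The value and the first two derivatives of `f` at `x` are bounded by `A`, `A / r`, `A / r²`. -/
structure JetBound (f : ℝ → ℝ) (x r A : ℝ) : Prop where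
  smooth : ContDiffAt ℝ 2 f x
  val : |f x| ≤ A
  fst : |deriv f x| * r ≤ A
  snd : |deriv (deriv f) x| * r ^ 2 ≤ A

theorem eventually_differentiableAt {f : ℝ → ℝ} {x : ℝ} (hf : ContDiffAt ℝ 2 f x) :
    ∀ᶠ y in 𝓝 x, DifferentiableAt ℝ f y := by
  filter_upwards [hf.eventually (by simp)] with y hy
  exact hy.differentiableAt (by simp)

theorem differentiableAt_deriv {f : ℝ → ℝ} {x : ℝ} (hf : ContDiffAt ℝ 2 f x) :
    DifferentiableAt ℝ (deriv f) x := by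
  have h : ContDiffAt ℝ 1 (deriv f) x := by
    have h' : ContDiffAt ℝ 1 (fderiv ℝ f) x := hf.fderiv_right (by norm_num)
    exact h'.clm_apply contDiffAt_const
  exact h.differentiableAt (by simp)

namespace JetBound

variable {f g : ℝ → ℝ} {x r A B : ℝ}

theorem mono (h : JetBound f x r A) (hAB : A ≤ B) : JetBound f x r B :=
  ⟨h.smooth, h.val.trans hAB, h.fst.trans hAB, h.snd.trans hAB⟩

theorem nonneg (h : JetBound f x r A) : 0 ≤ A := (abs_nonneg _).trans h.val

theorem congr (h : JetBound f x r A) (hfg : f =ᶠ[𝓝 x] g) : JetBound g x r A := by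
  refine ⟨h.smooth.congr_of_eventuallyEq hfg.symm, ?_, ?_, ?_⟩
  · rw [← hfg.eq_of_nhds]; exact h.val
  · rw [← hfg.deriv_eq]; exact h.fst
  · rw [← hfg.deriv.deriv_eq]; exact h.snd

theorem const (c x r : ℝ) : JetBound (fun _ => c) x r |c| :=
  ⟨contDiffAt_const, le_rfl, by simp, by simp⟩

theorem add (hf : JetBound f x r A) (hg : JetBound g x r B) (hr : 0 ≤ r) :
    JetBound (fun y => f y + g y) x r (A + B) := by
  have h1 : deriv (fun y => f y + g y) =ᶠ[𝓝 x] fun y => deriv f y + deriv g y := by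
    filter_upwards [eventually_differentiableAt hf.smooth, eventually_differentiableAt hg.smooth]
      with y h1 h2 using deriv_fun_add h1 h2
  refine ⟨hf.smooth.add hg.smooth, ?_, ?_, ?_⟩
  · exact (abs_add_le _ _).trans (add_le_add hf.val hg.val)
  · rw [h1.eq_of_nhds]
    calc _ ≤ (|deriv f x| + |deriv g x|) * r := by gcongr; exact abs_add_le _ _
      _ ≤ _ := by linarith [hf.fst, hg.fst]
  · rw [h1.deriv_eq, deriv_fun_add (differentiableAt_deriv hf.smooth)
      (differentiableAt_deriv hg.smooth)]
    calc _ ≤ (|deriv (deriv f) x| + |deriv (deriv g) x|) * r ^ 2 := by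
          gcongr; exact abs_add_le _ _
      _ ≤ _ := by linarith [hf.snd, hg.snd]

/-- The factor 4 = 1 + 2 + 1 is the sum of the Leibniz coefficients of the second derivative. -/
theorem mul (hf : JetBound f x r A) (hg : JetBound g x r B) (hr : 0 ≤ r) :
    JetBound (fun y => f y * g y) x r (4 * (A * B)) := by
  have hA := hf.nonneg
  have hB := hg.nonneg
  have h1 : deriv (fun y => f y * g y) =ᶠ[𝓝 x] fun y => deriv f y * g y + f y * deriv g y := by
    filter_upwards [eventually_differentiableAt hf.smooth, eventually_differentiableAt hg.smooth]
      with y h1 h2 using deriv_fun_mul h1 h2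
  have df := hf.smooth.differentiableAt (by simp)
  have dg := hg.smooth.differentiableAt (by simp)
  have ddf := differentiableAt_deriv hf.smooth
  have ddg := differentiableAt_deriv hg.smooth
  have b00 := mul_le_mul hf.val hg.val (abs_nonneg _) hA
  have b10 := mul_le_mul hf.fst hg.val (abs_nonneg _) hA
  have b01 := mul_le_mul hf.val hg.fst (by positivity) hA
  have b11 := mul_le_mul hf.fst hg.fst (by positivity) hA
  have b20 := mul_le_mul hf.snd hg.val (abs_nonneg _) hA
  have b02 := mul_le_mul hf.val hg.snd (by positivity) hA
  have hAB := mul_nonneg hA hB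
  refine ⟨hf.smooth.mul hg.smooth, ?_, ?_, ?_⟩
  · rw [abs_mul]; linarith
  · rw [h1.eq_of_nhds]
    calc _ ≤ (|deriv f x * g x| + |f x * deriv g x|) * r := by gcongr; exact abs_add_le _ _
      _ ≤ _ := by rw [abs_mul, abs_mul]; nlinarith
  · rw [h1.deriv_eq, deriv_fun_add (ddf.fun_mul dg) (df.fun_mul ddg), deriv_fun_mul ddf dg,
      deriv_fun_mul df ddg]
    calc _ ≤ (|deriv (deriv f) x * g x| + |deriv f x * deriv g x|
            + (|deriv f x * deriv g x| + |f x * deriv (deriv g) x|)) * r ^ 2 := by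
          gcongr
          exact (abs_add_le _ _).trans (add_le_add (abs_add_le _ _) (abs_add_le _ _))
      _ ≤ _ := by simp only [abs_mul]; nlinarith

theorem const_mul (hf : JetBound f x r A) (c : ℝ) :
    JetBound (fun y => c * f y) x r (|c| * A) := by
  have h1 : deriv (fun y => c * f y) = fun y => c * deriv f y := by
    ext y; exact deriv_const_mul_field c
  refine ⟨contDiffAt_const.mul hf.smooth, ?_, ?_, ?_⟩
  · rw [abs_mul]; exact mul_le_mul_of_nonneg_left hf.val (abs_nonneg c)
  · rw [h1, abs_mul, mul_assoc]; exact mul_le_mul_of_nonneg_left hf.fst (abs_nonneg c)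
  · rw [h1, deriv_const_mul_field, abs_mul, mul_assoc]
    exact mul_le_mul_of_nonneg_left hf.snd (abs_nonneg c)

theorem comp {G : ℝ → ℝ} (hf : JetBound f x r A) (hG : ContDiffAt ℝ 2 G (f x))
    (h0 : |G (f x)| ≤ B) (h1 : |deriv G (f x)| * A ≤ B)
    (h2 : |deriv (deriv G) (f x)| * A ^ 2 ≤ B) (hr : 0 ≤ r) :
    JetBound (fun y => G (f y)) x r (2 * B) := by
  have hA := hf.nonneg
  have hB : 0 ≤ B := (abs_nonneg _).trans h0
  have e1 : deriv (fun y => G (f y)) =ᶠ[𝓝 x] fun y => deriv G (f y) * deriv f y := by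
    filter_upwards [eventually_differentiableAt hf.smooth,
      hf.smooth.continuousAt.eventually (eventually_differentiableAt hG)] with y hy1 hy2
    exact (hy2.hasDerivAt.comp y hy1.hasDerivAt).deriv
  have e2 := (((differentiableAt_deriv hG).hasDerivAt.comp x
    (hf.smooth.differentiableAt (by simp)).hasDerivAt).mul
      (differentiableAt_deriv hf.smooth).hasDerivAt).deriv
  have e2' : deriv (fun y => deriv G (f y) * deriv f y) x =
    deriv (deriv G) (f x) * deriv f x * deriv f x + deriv G (f x) * deriv (deriv f) x := e2
  refine ⟨hG.comp x hf.smooth, by linarith, ?_, ?_⟩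
  · rw [e1.eq_of_nhds, abs_mul, mul_assoc]
    have := mul_le_mul_of_nonneg_left hf.fst (abs_nonneg (deriv G (f x)))
    linarith
  · rw [e1.deriv_eq, e2']
    have a1 := mul_le_mul hf.fst hf.fst (by positivity) hA
    have a2 := mul_le_mul_of_nonneg_left a1 (abs_nonneg (deriv (deriv G) (f x)))
    have a3 := mul_le_mul_of_nonneg_left hf.snd (abs_nonneg (deriv G (f x)))
    calc _ ≤ (|deriv (deriv G) (f x) * deriv f x * deriv f x|
            + |deriv G (f x) * deriv (deriv f) x|) * r ^ 2 := by gcongr; exact abs_add_le _ _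
      _ ≤ _ := by simp only [abs_mul]; nlinarith

theorem sq (hf : JetBound f x r A) (hr : 0 ≤ r) :
    JetBound (fun y => f y ^ 2) x r (4 * A ^ 2) := by
  simpa only [pow_two] using hf.mul hf hr

/-- The jet size `A` must be comparable, with ratio `K`, to a positive lower bound `c` of the value;
the derivatives of 1/y then scale as powers of 1/c. -/
theorem inv (hf : JetBound f x r A) (hr : 0 ≤ r) {c K : ℝ} (hc : 0 < c) (hcf : c ≤ f x)
    (hK : A ≤ K * c) (hK1 : 1 ≤ K) : JetBound (fun y => (f y)⁻¹) x r (4 * K ^ 2 / c) := by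
  have hA := hf.nonneg
  have hfx : 0 < f x := hc.trans_le hcf
  have hG : ContDiffAt ℝ 2 (fun y : ℝ => y⁻¹) (f x) := contDiffAt_inv ℝ hfx.ne'
  have d1 : deriv (fun y : ℝ => y⁻¹) = fun y => -(y ^ 2)⁻¹ := deriv_inv'
  have d2 : deriv (deriv (fun y : ℝ => y⁻¹)) (f x) = 2 * (f x)⁻¹ ^ 3 := by
    rw [d1]
    have := ((hasDerivAt_pow 2 (f x)).inv (pow_ne_zero 2 hfx.ne')).neg.deriv
    refine Eq.trans this ?_
    field_simp
    norm_num
    ring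
  have i1 : (f x)⁻¹ ≤ c⁻¹ := inv_anti₀ hc hcf
  have i0 : 0 < (f x)⁻¹ := inv_pos.2 hfx
  have := hf.comp (B := 2 * K ^ 2 / c) hG ?_ ?_ ?_ hr
  · exact this.mono (le_of_eq (by ring))
  · rw [abs_of_pos i0]
    calc (f x)⁻¹ ≤ 1 * c⁻¹ := by linarith
      _ ≤ (2 * K ^ 2) * c⁻¹ := by gcongr; nlinarith
      _ = _ := by ring
  · rw [d1]
    simp only [abs_neg, ← inv_pow, abs_of_pos (pow_pos i0 2)]
    calc (f x)⁻¹ ^ 2 * A ≤ c⁻¹ ^ 2 * (K * c) := by gcongr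
      _ = K / c := by field_simp
      _ ≤ _ := by gcongr; nlinarith
  · rw [d2, abs_of_pos (by positivity)]
    calc 2 * (f x)⁻¹ ^ 3 * A ^ 2 ≤ 2 * c⁻¹ ^ 3 * (K * c) ^ 2 := by gcongr
      _ = _ := by field_simp

/-- Only derivatives of logarithms are wanted, and the logarithm itself has no scale-invariant
bound; subtracting its value at `x` makes the zeroth-order bound trivial. -/
theorem log_sub (hf : JetBound f x r A) (hr : 0 ≤ r) {c K : ℝ} (hc : 0 < c) (hcf : c ≤ f x)
    (hK : A ≤ K * c) (hK1 : 1 ≤ K) :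
    JetBound (fun y => Real.log (f y) - Real.log (f x)) x r (2 * K ^ 2) := by
  have hA := hf.nonneg
  have hfx : 0 < f x := hc.trans_le hcf
  have hG : ContDiffAt ℝ 2 (fun y : ℝ => Real.log y - Real.log (f x)) (f x) :=
    (Real.contDiffAt_log.2 hfx.ne').sub contDiffAt_const
  have d1 : deriv (fun y : ℝ => Real.log y - Real.log (f x)) = fun y => y⁻¹ := by
    ext y; rw [deriv_sub_const_fun, Real.deriv_log]
  have d2 : deriv (deriv (fun y : ℝ => Real.log y - Real.log (f x))) (f x) = -(f x ^ 2)⁻¹ := by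
    rw [d1, deriv_inv']
  have i1 : (f x)⁻¹ ≤ c⁻¹ := inv_anti₀ hc hcf
  have i0 : 0 < (f x)⁻¹ := inv_pos.2 hfx
  refine hf.comp hG ?_ ?_ ?_ hr
  · simp; positivity
  · rw [d1]; simp only [abs_of_pos i0]
    calc (f x)⁻¹ * A ≤ c⁻¹ * (K * c) := by gcongr
      _ = K := by field_simp
      _ ≤ _ := by nlinarith
  · rw [d2, abs_neg, ← inv_pow, abs_of_pos (pow_pos i0 2)]
    calc (f x)⁻¹ ^ 2 * A ^ 2 ≤ c⁻¹ ^ 2 * (K * c) ^ 2 := by gcongr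
      _ = _ := by field_simp

theorem sqrt (hf : JetBound f x r (8 * r ^ 2)) (hr : 0 < r) (hfx : f x = r ^ 2) :
    JetBound (fun y => √(f y)) x r (32 * r) := by
  have hpos : 0 < f x := by rw [hfx]; positivity
  have hs : √(f x) = r := by rw [hfx]; exact Real.sqrt_sq hr.le
  have d1 : deriv (fun y : ℝ => √y) =ᶠ[𝓝 (f x)] fun y => (2 * √y)⁻¹ := by
    filter_upwards [lt_mem_nhds hpos] with y hy
    rw [(Real.hasDerivAt_sqrt hy.ne').deriv, one_div]
  have d2 : deriv (deriv (fun y : ℝ => √y)) (f x) = -(4 * r ^ 3)⁻¹ := by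
    rw [d1.deriv_eq]
    have := (((Real.hasDerivAt_sqrt hpos.ne').const_mul 2).inv (by rw [hs]; positivity)).deriv
    refine Eq.trans this ?_
    rw [hs]; field_simp; norm_num
  have := hf.comp (B := 16 * r) (Real.contDiffAt_sqrt hpos.ne') ?_ ?_ ?_ hr.le
  · exact this.mono (le_of_eq (by ring))
  · rw [hs, abs_of_pos hr]; linarith
  · rw [d1.eq_of_nhds]; simp only [hs]
    rw [abs_of_pos (by positivity)]
    calc (2 * r)⁻¹ * (8 * r ^ 2) = 4 * r := by field_simp; norm_num
      _ ≤ _ := by linarith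
  · rw [d2, abs_neg, abs_of_pos (by positivity)]
    exact le_of_eq (by field_simp; norm_num)

end JetBound

/-! ### Pointwise size of the extreme Kerr background -/

/-- The numerator of `η₀`. -/
noncomputable def kerrN (m ρ z : ℝ) : ℝ :=
  ((rad ρ z + m) ^ 2 + m ^ 2) ^ 2 - rad ρ z ^ 2 * m ^ 2 * sinTheta ρ z ^ 2

section Pointwise

variable {m ρ z : ℝ}

theorem rad_pos (hρ : 0 < ρ) : 0 < rad ρ z := Real.sqrt_pos.2 (by positivity)

theorem rad_sq (ρ z : ℝ) : rad ρ z ^ 2 = ρ ^ 2 + z ^ 2 := Real.sq_sqrt (by positivity)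

theorem sinTheta_pos (hρ : 0 < ρ) : 0 < sinTheta ρ z := div_pos hρ (rad_pos hρ)

theorem sinTheta_sq_add_cosTheta_sq (hρ : 0 < ρ) : sinTheta ρ z ^ 2 + cosTheta ρ z ^ 2 = 1 := by
  have := (rad_pos (z := z) hρ).ne'
  rw [sinTheta, cosTheta]
  field_simp
  rw [rad_sq]

theorem sinTheta_le_one (hρ : 0 < ρ) : sinTheta ρ z ≤ 1 := by
  nlinarith [sinTheta_sq_add_cosTheta_sq (z := z) hρ, sq_nonneg (cosTheta ρ z),
    sinTheta_pos (z := z) hρ]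

theorem cosTheta_sq_le_one (hρ : 0 < ρ) : cosTheta ρ z ^ 2 ≤ 1 := by
  nlinarith [sinTheta_sq_add_cosTheta_sq (z := z) hρ, sq_nonneg (sinTheta ρ z)]

theorem le_kerrSigma (m ρ z : ℝ) : (rad ρ z + m) ^ 2 ≤ kerrSigma m ρ z := by
  rw [kerrSigma]; nlinarith [sq_nonneg (m * cosTheta ρ z)]

theorem kerrSigma_le (hm : 0 < m) (hρ : 0 < ρ) : kerrSigma m ρ z ≤ 2 * (rad ρ z + m) ^ 2 := by
  have := rad_pos (z := z) hρ
  have h1 := mul_le_mul_of_nonneg_left (cosTheta_sq_le_one (z := z) hρ) (sq_nonneg m)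
  rw [kerrSigma]; nlinarith

theorem kerrSigma_pos (hm : 0 < m) (hρ : 0 < ρ) : 0 < kerrSigma m ρ z := by
  have := rad_pos (z := z) hρ
  exact lt_of_lt_of_le (by positivity) (le_kerrSigma m ρ z)

/-- With R = r + m, the subtracted term is at most R² m², which the cross term 2 R² m² of the square
absorbs. -/
theorem le_kerrN (hm : 0 < m) (hρ : 0 < ρ) : (rad ρ z + m) ^ 4 ≤ kerrN m ρ z := by
  have hr := rad_pos (z := z) hρ
  have hs : sinTheta ρ z ^ 2 ≤ 1 := by
    nlinarith [sinTheta_sq_add_cosTheta_sq (z := z) hρ, sq_nonneg (cosTheta ρ z)]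
  have h1 : rad ρ z ^ 2 * m ^ 2 * sinTheta ρ z ^ 2 ≤ (rad ρ z + m) ^ 2 * m ^ 2 * 1 := by
    gcongr; linarith
  rw [kerrN]
  nlinarith [mul_pos (pow_pos (add_pos hr hm) 2) (pow_pos hm 2), pow_pos hm 4]

theorem kerrN_le (hm : 0 < m) (hρ : 0 < ρ) : kerrN m ρ z ≤ 4 * (rad ρ z + m) ^ 4 := by
  have hr := rad_pos (z := z) hρ
  have h1 : ((rad ρ z + m) ^ 2 + m ^ 2) ^ 2 ≤ ((rad ρ z + m) ^ 2 + (rad ρ z + m) ^ 2) ^ 2 := by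
    gcongr; linarith
  have h2 : 0 ≤ rad ρ z ^ 2 * m ^ 2 * sinTheta ρ z ^ 2 := by positivity
  rw [kerrN]
  nlinarith

theorem kerrN_pos (hm : 0 < m) (hρ : 0 < ρ) : 0 < kerrN m ρ z := by
  have := rad_pos (z := z) hρ
  exact lt_of_lt_of_le (by positivity) (le_kerrN hm hρ)

theorem eta0_eq (m ρ z : ℝ) :
    eta0 m ρ z = kerrN m ρ z * (kerrSigma m ρ z)⁻¹ * sinTheta ρ z ^ 2 := rfl

theorem eta0_pos (hm : 0 < m) (hρ : 0 < ρ) : 0 < eta0 m ρ z := by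
  have := kerrN_pos (z := z) hm hρ
  have := kerrSigma_pos (z := z) hm hρ
  have := sinTheta_pos (z := z) hρ
  rw [eta0_eq]; positivity

theorem eta0_le (hm : 0 < m) (hρ : 0 < ρ) :
    eta0 m ρ z ≤ 4 * ((rad ρ z + m) ^ 2 * sinTheta ρ z ^ 2) := by
  have hr := rad_pos (z := z) hρ
  have h1 := kerrN_le (z := z) hm hρ
  have h2 := kerrN_pos (z := z) hm hρ
  have h3 := le_kerrSigma m ρ z
  have h4 : (kerrSigma m ρ z)⁻¹ ≤ ((rad ρ z + m) ^ 2)⁻¹ := inv_anti₀ (by positivity) h3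
  calc _ ≤ 4 * (rad ρ z + m) ^ 4 * ((rad ρ z + m) ^ 2)⁻¹ * sinTheta ρ z ^ 2 := by
        rw [eta0_eq]; gcongr
        exact (inv_pos.2 (kerrSigma_pos hm hρ)).le
    _ = _ := by field_simp

theorem le_eta0 (hm : 0 < m) (hρ : 0 < ρ) :
    (rad ρ z + m) ^ 2 * sinTheta ρ z ^ 2 ≤ 2 * eta0 m ρ z := by
  have hr := rad_pos (z := z) hρ
  have h1 := le_kerrN (z := z) hm hρ
  have h2 := kerrSigma_pos (z := z) hm hρ
  have h3 := kerrSigma_le (z := z) hm hρ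
  have h4 : (2 * (rad ρ z + m) ^ 2)⁻¹ ≤ (kerrSigma m ρ z)⁻¹ := inv_anti₀ h2 h3
  calc _ = 2 * ((rad ρ z + m) ^ 4 * (2 * (rad ρ z + m) ^ 2)⁻¹ * sinTheta ρ z ^ 2) := by
        field_simp
    _ ≤ _ := by
        rw [eta0_eq]; gcongr
        exact (kerrN_pos hm hρ).le

/-- The conformal factor has no angular singularity: exp(2(q₀ + σ₀)) = Σ η₀ sin²θ / ρ⁴, and η₀ = N
sin²θ / Σ cancels Σ and every power of sin θ. -/
theorem exp_neg_two_q0_add_sigma0 (hm : 0 < m) (hρ : 0 < ρ) :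
    Real.exp (-2 * (q0 m ρ z + sigma0 m ρ z)) = rad ρ z ^ 4 / kerrN m ρ z := by
  have hr := rad_pos (z := z) hρ
  have hN := kerrN_pos (z := z) hm hρ
  have hS := kerrSigma_pos (z := z) hm hρ
  have hs := sinTheta_pos (z := z) hρ
  have hη := eta0_pos (z := z) hm hρ
  have e : -2 * (q0 m ρ z + sigma0 m ρ z) =
      -(Real.log (kerrSigma m ρ z * sinTheta ρ z ^ 2 / eta0 m ρ z)
        + 2 * Real.log (eta0 m ρ z / ρ ^ 2)) := by
    rw [q0, sigma0]; ring
  rw [e, Real.exp_neg, Real.exp_add, two_mul, Real.exp_add, Real.exp_log (by positivity),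
    Real.exp_log (by positivity), eta0_eq]
  rw [sinTheta]
  field_simp

theorem exp_neg_two_q0_add_sigma0_le (hm : 0 < m) (hρ : 0 < ρ) :
    Real.exp (-2 * (q0 m ρ z + sigma0 m ρ z)) * m ^ 2 ≤ rad ρ z ^ 2 := by
  have hr := rad_pos (z := z) hρ
  have hN := kerrN_pos (z := z) hm hρ
  have h : rad ρ z ^ 2 * m ^ 2 ≤ kerrN m ρ z := by
    refine le_trans ?_ (le_kerrN hm hρ)
    calc rad ρ z ^ 2 * m ^ 2 ≤ (rad ρ z + m) ^ 2 * (rad ρ z + m) ^ 2 := by gcongr <;> linarith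
      _ = _ := by ring
  rw [exp_neg_two_q0_add_sigma0 hm hρ, div_mul_eq_mul_div, div_le_iff₀ hN]
  nlinarith [sq_nonneg (rad ρ z)]

/-- The factor sin²θ of η₀ cancels against ρ², so σ₀ is a combination of logarithms of functions
with good jets, with no singularity on the axis. -/
theorem sigma0_eq (hm : 0 < m) (hρ : 0 < ρ) : sigma0 m ρ z =
    Real.log (kerrN m ρ z) - Real.log (kerrSigma m ρ z) - 2 * Real.log (rad ρ z) := by
  have hr := rad_pos (z := z) hρ
  have hN := kerrN_pos (z := z) hm hρ
  have hS := kerrSigma_pos (z := z) hm hρ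
  have e : eta0 m ρ z / ρ ^ 2 = kerrN m ρ z / kerrSigma m ρ z / rad ρ z ^ 2 := by
    rw [eta0_eq, sinTheta]; field_simp
  rw [sigma0, e, Real.log_div (by positivity) (by positivity), Real.log_div hN.ne' hS.ne',
    Real.log_pow]
  norm_num

end Pointwise

/-! ### Jets of the background along both coordinate directions at once -/

/-- A parametrized curve in the half plane whose coordinates have derivatives controlled by the
distance `r` to the horizon, at the parameter `x`. -/
structure CoordLine (X Y : ℝ → ℝ) (x r : ℝ) : Prop where
  fst : JetBound X x r r
  snd : JetBound Y x r r
  pos : 0 < X x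
  eq_rad : r = rad (X x) (Y x)

theorem coordLine_rho {ρ z : ℝ} (hρ : 0 < ρ) :
    CoordLine (fun s => s) (fun _ => z) ρ (rad ρ z) := by
  have hr := rad_pos (z := z) hρ
  refine ⟨⟨contDiffAt_id, ?_, by simp, ?_⟩, (JetBound.const z ρ _).mono ?_, hρ, rfl⟩
  · exact Real.abs_le_sqrt (by nlinarith [sq_nonneg z])
  · simp [hr.le]
  · exact Real.abs_le_sqrt (by nlinarith [sq_nonneg ρ])

theorem coordLine_z {ρ z : ℝ} (hρ : 0 < ρ) :
    CoordLine (fun _ => ρ) (fun s => s) z (rad ρ z) := by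
  have hr := rad_pos (z := z) hρ
  refine ⟨(JetBound.const ρ z _).mono ?_, ⟨contDiffAt_id, ?_, by simp, ?_⟩, hρ, rfl⟩
  · exact Real.abs_le_sqrt (by nlinarith [sq_nonneg z])
  · exact Real.abs_le_sqrt (by nlinarith [sq_nonneg ρ])
  · simp [hr.le]

namespace CoordLine

variable {X Y : ℝ → ℝ} {x r m : ℝ}

theorem r_pos (h : CoordLine X Y x r) : 0 < r := by rw [h.eq_rad]; exact rad_pos h.pos

theorem eventually_pos (h : CoordLine X Y x r) : ∀ᶠ s in 𝓝 x, 0 < X s :=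
  h.fst.smooth.continuousAt.eventually (lt_mem_nhds h.pos)

theorem jet_rad (h : CoordLine X Y x r) : JetBound (fun s => rad (X s) (Y s)) x r (32 * r) := by
  have hr := h.r_pos
  refine JetBound.sqrt (((h.fst.sq hr.le).add (h.snd.sq hr.le) hr.le).mono ?_) hr ?_
  · linarith
  · rw [h.eq_rad, rad_sq]

theorem jet_rad_inv (h : CoordLine X Y x r) :
    JetBound (fun s => (rad (X s) (Y s))⁻¹) x r (4096 / r) := by
  have := h.jet_rad.inv h.r_pos.le h.r_pos h.eq_rad.le le_rfl (by norm_num)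
  exact this.mono (le_of_eq (by norm_num))

theorem jet_sinTheta (h : CoordLine X Y x r) :
    JetBound (fun s => sinTheta (X s) (Y s)) x r 16384 := by
  have hr := h.r_pos
  refine (h.fst.mul h.jet_rad_inv hr.le).mono (le_of_eq ?_)
  field_simp; norm_num

theorem jet_cosTheta (h : CoordLine X Y x r) :
    JetBound (fun s => cosTheta (X s) (Y s)) x r 16384 := by
  have hr := h.r_pos
  refine (h.snd.mul h.jet_rad_inv hr.le).mono (le_of_eq ?_)
  field_simp; norm_num

theorem jet_rad_add_sq (h : CoordLine X Y x r) (hm : 0 < m) :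
    JetBound (fun s => (rad (X s) (Y s) + m) ^ 2) x r (4096 * (r + m) ^ 2) := by
  have hr := h.r_pos
  have h1 : JetBound (fun s => rad (X s) (Y s) + m) x r (32 * (r + m)) := by
    refine (h.jet_rad.add (JetBound.const m x r) hr.le).mono ?_
    rw [abs_of_pos hm]; linarith
  exact (h1.sq hr.le).mono (le_of_eq (by ring))

theorem exists_jet_kerrSigma : ∃ K : ℝ, 1 ≤ K ∧ ∀ {X Y : ℝ → ℝ} {x r m : ℝ},
    CoordLine X Y x r → 0 < m →
      JetBound (fun s => kerrSigma m (X s) (Y s)) x r (K * (r + m) ^ 2) := by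
  refine ⟨4096 + 4 * 16384 ^ 2, by norm_num, fun {X Y x r m} h hm => ?_⟩
  have hr := h.r_pos
  refine ((h.jet_rad_add_sq hm).add ((h.jet_cosTheta.sq hr.le).const_mul (m ^ 2)) hr.le).mono ?_
  rw [abs_of_pos (by positivity)]
  have : m ^ 2 ≤ (r + m) ^ 2 := by gcongr; linarith
  linarith

theorem exists_jet_kerrSigma_inv : ∃ K : ℝ, 1 ≤ K ∧ ∀ {X Y : ℝ → ℝ} {x r m : ℝ},
    CoordLine X Y x r → 0 < m →
      JetBound (fun s => (kerrSigma m (X s) (Y s))⁻¹) x r (K / (r + m) ^ 2) := by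
  obtain ⟨K, hK1, hK⟩ := exists_jet_kerrSigma
  refine ⟨4 * K ^ 2, by nlinarith, fun {X Y x r m} h hm => ?_⟩
  have hr := h.r_pos
  exact (hK h hm).inv hr.le (by positivity) (by rw [h.eq_rad]; exact le_kerrSigma _ _ _) le_rfl hK1

theorem exists_jet_kerrN : ∃ K : ℝ, 1 ≤ K ∧ ∀ {X Y : ℝ → ℝ} {x r m : ℝ},
    CoordLine X Y x r → 0 < m →
      JetBound (fun s => kerrN m (X s) (Y s)) x r (K * (r + m) ^ 4) := by
  refine ⟨4 * 4097 ^ 2 + 4 * 4096 * (4 * 16384 ^ 2), by norm_num, fun {X Y x r m} h hm => ?_⟩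
  have hr := h.r_pos
  have h1 := (((h.jet_rad_add_sq hm).add (JetBound.const (m ^ 2) x r) hr.le).sq hr.le).add
    ((((h.jet_rad.sq hr.le).mul (h.jet_sinTheta.sq hr.le) hr.le).const_mul (-m ^ 2))) hr.le
  refine (h1.mono ?_).congr (Eventually.of_forall fun s => ?_)
  · rw [abs_neg, abs_of_pos (by positivity : 0 < m ^ 2)]
    have i1 : m ^ 2 ≤ (r + m) ^ 2 := by gcongr; linarith
    have i2 : r ^ 2 ≤ (r + m) ^ 2 := by gcongr; linarith
    calc _ ≤ 4 * (4096 * (r + m) ^ 2 + (r + m) ^ 2) ^ 2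
          + (r + m) ^ 2 * (4 * (4 * (32 ^ 2 * (r + m) ^ 2) * (4 * 16384 ^ 2))) := by
          rw [mul_pow 32 r]; gcongr
      _ = _ := by ring
  · simp only [kerrN]; ring

/-- Each of the logarithms in `sigma0_eq` has an argument whose jet is comparable to its value, so
the derivatives of σ₀ scale like 1/r and 1/r². -/
theorem exists_deriv_sigma0 : ∃ K : ℝ, 1 ≤ K ∧ ∀ {X Y : ℝ → ℝ} {x r m : ℝ},
    CoordLine X Y x r → 0 < m →
      ContDiffAt ℝ 2 (fun s => sigma0 m (X s) (Y s)) x ∧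
      |deriv (fun s => sigma0 m (X s) (Y s)) x| * r ≤ K ∧
      |deriv (deriv (fun s => sigma0 m (X s) (Y s))) x| * r ^ 2 ≤ K := by
  obtain ⟨K1, hK1, h1⟩ := exists_jet_kerrN
  obtain ⟨K2, hK2, h2⟩ := exists_jet_kerrSigma
  refine ⟨2 * K1 ^ 2 + 2 * K2 ^ 2 + 2 * (2 * 32 ^ 2), by nlinarith, fun {X Y x r m} h hm => ?_⟩
  have hr := h.r_pos
  have j1 := (h1 h hm).log_sub hr.le (by positivity)
    (by rw [h.eq_rad]; exact le_kerrN hm h.pos) le_rfl hK1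
  have j2 := (h2 h hm).log_sub hr.le (by positivity)
    (by rw [h.eq_rad]; exact le_kerrSigma _ _ _) le_rfl hK2
  have j3 := h.jet_rad.log_sub hr.le hr h.eq_rad.le le_rfl (by norm_num)
  have j := (j1.add (j2.const_mul (-1)) hr.le).add (j3.const_mul (-2)) hr.le
  have e : (fun s => Real.log (kerrN m (X s) (Y s)) - Real.log (kerrN m (X x) (Y x))
      + -1 * (Real.log (kerrSigma m (X s) (Y s)) - Real.log (kerrSigma m (X x) (Y x)))
      + -2 * (Real.log (rad (X s) (Y s)) - Real.log (rad (X x) (Y x)))) =ᶠ[𝓝 x]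
      fun s => sigma0 m (X s) (Y s) - sigma0 m (X x) (Y x) := by
    filter_upwards [h.eventually_pos] with s hs
    rw [sigma0_eq hm hs, sigma0_eq hm h.pos]; ring
  have j' := (j.congr e).mono (B := 2 * K1 ^ 2 + 2 * K2 ^ 2 + 2 * (2 * 32 ^ 2)) (by norm_num)
  have d1 : deriv (fun s => sigma0 m (X s) (Y s) - sigma0 m (X x) (Y x)) =
      deriv (fun s => sigma0 m (X s) (Y s)) := by
    ext s; rw [deriv_sub_const_fun]
  refine ⟨?_, ?_, ?_⟩
  · simpa using j'.smooth.add (contDiffAt_const (c := sigma0 m (X x) (Y x)))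
  · rw [← d1]; exact j'.fst
  · rw [← d1]; exact j'.snd

/-- Differentiating sin²θ leaves one factor sin θ; this single power decides which angular weight b²
must carry later. -/
theorem exists_deriv_eta0 : ∃ K : ℝ, 1 ≤ K ∧ ∀ {X Y : ℝ → ℝ} {x r m : ℝ},
    CoordLine X Y x r → 0 < m →
      |deriv (fun s => eta0 m (X s) (Y s)) x| * r ≤ K * ((r + m) ^ 2 * sinTheta (X x) (Y x)) := by
  obtain ⟨K1, hK1, h1⟩ := exists_jet_kerrN
  obtain ⟨K2, hK2, h2⟩ := exists_jet_kerrSigma_inv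
  refine ⟨4 * (K1 * K2) * (1 + 2 * 16384), by nlinarith, fun {X Y x r m} h hm => ?_⟩
  have hr := h.r_pos
  have jG := ((h1 h hm).mul (h2 h hm) hr.le).mono (B := 4 * (K1 * K2) * (r + m) ^ 2)
    (le_of_eq (by field_simp))
  have jS := h.jet_sinTheta
  have s0 := sinTheta_pos (z := Y x) h.pos
  have s1 := sinTheta_le_one (z := Y x) h.pos
  have hd := (jG.smooth.differentiableAt (by simp)).hasDerivAt.mul
    ((jS.smooth.differentiableAt (by simp)).hasDerivAt.pow 2)
  have hd' : HasDerivAt (fun s => eta0 m (X s) (Y s)) _ x := hd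
  rw [hd'.deriv]
  set G := fun s => kerrN m (X s) (Y s) * (kerrSigma m (X s) (Y s))⁻¹
  set S := fun s => sinTheta (X s) (Y s)
  set Q := 4 * (K1 * K2) * (r + m) ^ 2 with hQ
  have hQ0 : 0 ≤ Q := jG.nonneg
  have s0' : 0 < S x := s0
  have s1' : S x ≤ 1 := s1
  calc _ ≤ (|deriv G x * S x ^ 2| + |G x * (2 * S x * deriv S x)|) * r := by
        gcongr
        refine le_trans (le_of_eq (congrArg abs ?_)) (abs_add_le _ _)
        simp only [Pi.pow_apply]; push_cast; ring
    _ = (|deriv G x| * r) * S x ^ 2 + |G x| * (2 * S x * (|deriv S x| * r)) := by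
        simp only [abs_mul, abs_two, abs_of_pos s0', abs_of_pos (pow_pos s0' 2)]; ring
    _ ≤ Q * (S x * 1) + Q * (2 * S x * 16384) := by
        gcongr
        · exact jG.fst
        · rw [pow_two]; gcongr
        · exact jG.val
        · exact jS.fst
    _ = _ := by rw [hQ]; ring

/-- The leading part gives d(c³ − 3c) = −3 sin²θ dc, with c = cos θ, and the other part retains at
least sin³θ. So |∂ω₀| r is of order m² sin²θ, hence dominated by η₀. -/
theorem exists_deriv_omega0 : ∃ K : ℝ, 1 ≤ K ∧ ∀ {X Y : ℝ → ℝ} {x r m : ℝ},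
    CoordLine X Y x r → 0 < m →
      |deriv (fun s => omega0 m (X s) (Y s)) x| * r ≤ K * m ^ 2 * sinTheta (X x) (Y x) ^ 2 := by
  obtain ⟨K, hK1, hK⟩ := exists_jet_kerrSigma_inv
  refine ⟨6 * 16384 + 2 * (16384 * K + K + 4 * (K * 16384)), by nlinarith,
    fun {X Y x r m} h hm => ?_⟩
  have hr := h.r_pos
  have jS := h.jet_sinTheta
  have jC := h.jet_cosTheta
  have jV := hK h hm
  have s0 := sinTheta_pos (z := Y x) h.pos
  have s1 := sinTheta_le_one (z := Y x) h.pos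
  have sc := sinTheta_sq_add_cosTheta_sq (z := Y x) h.pos
  have c1 : |cosTheta (X x) (Y x)| ≤ 1 := by
    rw [← sq_le_one_iff_abs_le_one]; exact cosTheta_sq_le_one h.pos
  have dS := (jS.smooth.differentiableAt (by simp)).hasDerivAt
  have dC := (jC.smooth.differentiableAt (by simp)).hasDerivAt
  have dV := (jV.smooth.differentiableAt (by simp)).hasDerivAt
  have hd := (((dC.pow 3).sub (dC.const_mul 3)).const_mul (2 * m ^ 2)).sub
    (((dC.const_mul (2 * m ^ 4)).mul (dS.pow 4)).mul dV)
  have hd' : HasDerivAt (fun s => omega0 m (X s) (Y s)) _ x := hd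
  rw [hd'.deriv]
  set V := fun s => (kerrSigma m (X s) (Y s))⁻¹
  set S := fun s => sinTheta (X s) (Y s)
  set C := fun s => cosTheta (X s) (Y s)
  change 0 < S x at s0
  change S x ≤ 1 at s1
  change |C x| ≤ 1 at c1
  change S x ^ 2 + C x ^ 2 = 1 at sc
  have hmR : m ^ 2 * (K / (r + m) ^ 2) ≤ K := by
    have : m ^ 2 ≤ (r + m) ^ 2 := by gcongr; linarith
    rw [mul_div_assoc', div_le_iff₀ (by positivity)]
    nlinarith
  have v0 : m ^ 2 * |V x| ≤ K := (mul_le_mul_of_nonneg_left jV.val (by positivity)).trans hmR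
  have v1 : m ^ 2 * (|deriv V x| * r) ≤ K :=
    (mul_le_mul_of_nonneg_left jV.fst (by positivity)).trans hmR
  have p3 : S x ^ 3 ≤ S x ^ 2 := pow_le_pow_of_le_one s0.le s1 (by norm_num)
  have p4 : S x ^ 4 ≤ S x ^ 2 := pow_le_pow_of_le_one s0.le s1 (by norm_num)
  calc _ ≤ (|6 * m ^ 2 * S x ^ 2 * deriv C x| + 2 * m ^ 2 * (|m ^ 2 * V x * deriv C x * S x ^ 4|
          + |C x * (m ^ 2 * deriv V x) * S x ^ 4|
          + |4 * C x * (m ^ 2 * V x) * S x ^ 3 * deriv S x|)) * r := by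
        gcongr
        have t1 := abs_add_le (-(6 * m ^ 2 * S x ^ 2 * deriv C x))
          (-(2 * m ^ 2 * (m ^ 2 * V x * deriv C x * S x ^ 4 + C x * (m ^ 2 * deriv V x) * S x ^ 4
            + 4 * C x * (m ^ 2 * V x) * S x ^ 3 * deriv S x)))
        have t2 := abs_add_three (m ^ 2 * V x * deriv C x * S x ^ 4)
          (C x * (m ^ 2 * deriv V x) * S x ^ 4) (4 * C x * (m ^ 2 * V x) * S x ^ 3 * deriv S x)
        rw [abs_neg, abs_neg, abs_mul (2 * m ^ 2), abs_of_pos (by positivity : 0 < 2 * m ^ 2)] at t1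
        have t3 := mul_le_mul_of_nonneg_left t2 (by positivity : 0 ≤ 2 * m ^ 2)
        refine le_trans (le_of_eq (congrArg abs ?_)) (t1.trans (by linarith))
        simp only [Pi.pow_apply, Pi.mul_apply]
        push_cast
        -- Here 3 cos²θ − 3 is replaced by −3 sin²θ.
        linear_combination 6 * m ^ 2 * deriv C x * sc
    _ = 6 * m ^ 2 * S x ^ 2 * (|deriv C x| * r) + 2 * m ^ 2 * (m ^ 2 * |V x| * (|deriv C x| * r)
          * S x ^ 4 + |C x| * (m ^ 2 * (|deriv V x| * r)) * S x ^ 4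
          + 4 * |C x| * (m ^ 2 * |V x|) * S x ^ 3 * (|deriv S x| * r)) := by
        simp only [abs_mul, abs_of_pos s0, abs_of_pos hm, abs_pow,
          abs_of_pos (by norm_num : (0 : ℝ) < 6), abs_of_pos (by norm_num : (0 : ℝ) < 4)]
        ring
    _ ≤ 6 * m ^ 2 * S x ^ 2 * 16384 + 2 * m ^ 2 * (K * 16384 * S x ^ 2
          + 1 * K * S x ^ 2 + 4 * 1 * K * S x ^ 2 * 16384) := by
        gcongr
        · exact jC.fst
        · exact jC.fst
        · exact jS.fst
    _ = _ := by ring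

end CoordLine

/-! ### One-dimensional Hardy inequalities -/

section OneDimensional

/-- Integrate P − Q ≤ F'. The one-sided form of the fundamental theorem of calculus spares the
integrability of F', and a Hardy inequality reduces to choosing F with F b ≤ F a. -/
theorem lintegral_Icc_le_of_le_add_deriv {a b : ℝ} (hab : a ≤ b) {P Q F F' : ℝ → ℝ}
    (hP : ContinuousOn P (Icc a b)) (hQ : ContinuousOn Q (Icc a b))
    (hP0 : ∀ x ∈ Icc a b, 0 ≤ P x) (hQ0 : ∀ x ∈ Icc a b, 0 ≤ Q x)
    (hF : ∀ x ∈ Icc a b, HasDerivAt F (F' x) x) (hle : ∀ x ∈ Icc a b, P x ≤ Q x + F' x)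
    (hFab : F b ≤ F a) :
    ∫⁻ x in Icc a b, ENNReal.ofReal (P x) ≤ ∫⁻ x in Icc a b, ENNReal.ofReal (Q x) := by
  have iP : IntegrableOn P (Icc a b) := hP.integrableOn_Icc
  have iQ : IntegrableOn Q (Icc a b) := hQ.integrableOn_Icc
  have h1 := intervalIntegral.sub_le_integral_of_hasDeriv_right_of_le hab
    (g := fun x => -F x) (g' := fun x => -F' x) (φ := fun x => Q x - P x)
    (fun x hx => (hF x hx).continuousAt.continuousWithinAt.neg)
    (fun x hx => (hF x (Ioo_subset_Icc_self hx)).neg.hasDerivWithinAt) (iQ.sub iP)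
    (fun x hx => by linarith [hle x (Ioo_subset_Icc_self hx)])
  rw [intervalIntegral.integral_of_le hab, ← integral_Icc_eq_integral_Ioc,
    integral_sub iQ iP] at h1
  rw [← ofReal_integral_eq_lintegral_ofReal iP, ← ofReal_integral_eq_lintegral_ofReal iQ]
  · exact ENNReal.ofReal_le_ofReal (by linarith)
  · exact (ae_restrict_iff' measurableSet_Icc).2 (Eventually.of_forall hQ0)
  · exact (ae_restrict_iff' measurableSet_Icc).2 (Eventually.of_forall hP0)

/-- Fatou's lemma. The integrand may vary with the compact set, which leaves room for the truncation
in `hardy_radial`. -/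
theorem lintegral_le_of_exhaustion {s : Set ℝ} (hs : MeasurableSet s) {K : ℕ → Set ℝ}
    (hK : ∀ n, MeasurableSet (K n)) (hKs : ∀ n, K n ⊆ s) (hmem : ∀ x ∈ s, ∀ᶠ n in atTop, x ∈ K n)
    {P : ℝ → ℝ} {Pn : ℕ → ℝ → ℝ} (hc : ∀ n, ContinuousOn (Pn n) s)
    (hlim : ∀ x ∈ s, Tendsto (fun n => Pn n x) atTop (𝓝 (P x))) {B : ℝ≥0∞}
    (hB : ∀ n, ∫⁻ x in K n, ENNReal.ofReal (Pn n x) ≤ B) :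
    ∫⁻ x in s, ENNReal.ofReal (P x) ≤ B := by
  calc ∫⁻ x in s, ENNReal.ofReal (P x)
      = ∫⁻ x in s, liminf (fun n => (K n).indicator (fun y => ENNReal.ofReal (Pn n y)) x) atTop := by
        refine setLIntegral_congr_fun hs fun x hx => ?_
        have h1 : Tendsto (fun n => (K n).indicator (fun y => ENNReal.ofReal (Pn n y)) x) atTop
            (𝓝 (ENNReal.ofReal (P x))) := by
          refine (ENNReal.tendsto_ofReal (hlim x hx)).congr' ?_
          filter_upwards [hmem x hx] with n hn
          rw [indicator_of_mem hn]
        exact h1.liminf_eq.symm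
    _ ≤ liminf (fun n => ∫⁻ x in s, (K n).indicator (fun y => ENNReal.ofReal (Pn n y)) x) atTop := by
        refine lintegral_liminf_le' fun n => ?_
        exact (((hc n).aemeasurable hs).ennreal_ofReal).indicator (hK n)
    _ ≤ liminf (fun _ : ℕ => B) atTop := by
        refine liminf_le_liminf (Eventually.of_forall fun n => ?_)
        rw [setLIntegral_indicator (hK n), inter_eq_left.2 (hKs n)]
        exact hB n
    _ = B := liminf_const B

/-- The multiplier is F = 2 r (r + m)^k f². Since the weight (r + m)^k is increasing, its derivative
has the good sign and the constant 4 is that of the unweighted inequality. -/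
theorem hardy_radial {m : ℝ} (hm : 0 ≤ m) (k : ℕ) {f f' : ℝ → ℝ}
    (hf : ∀ r ∈ Ioi (0 : ℝ), HasDerivAt f (f' r) r) (hf' : ContinuousOn f' (Ioi 0))
    (hlim : Tendsto f atTop (𝓝 0)) :
    ∫⁻ r in Ioi (0 : ℝ), ENNReal.ofReal ((r + m) ^ k * f r ^ 2) ≤
      ∫⁻ r in Ioi (0 : ℝ), ENNReal.ofReal (4 * ((r + m) ^ k * (r ^ 2 * f' r ^ 2))) := by
  have hfc : ContinuousOn f (Ioi 0) := fun r hr => (hf r hr).continuousAt.continuousWithinAt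
  have htop : Tendsto (fun n : ℕ => (n : ℝ) + 1) atTop atTop :=
    tendsto_atTop_add_const_right _ _ tendsto_natCast_atTop_atTop
  have hKs : ∀ n : ℕ, Icc (1 / ((n : ℝ) + 1)) (n + 1) ⊆ Ioi (0 : ℝ) := fun n x hx =>
    lt_of_lt_of_le (by positivity) hx.1
  refine lintegral_le_of_exhaustion measurableSet_Ioi
    (K := fun n : ℕ => Icc (1 / ((n : ℝ) + 1)) (n + 1)) (fun n => measurableSet_Icc) hKs ?_
    -- Subtracting the value at the outer endpoint kills the outer boundary term without any rate of
    -- decay of f; the inner boundary term is nonnegative and is dropped. The constant tends to 0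
    -- with n.
    (Pn := fun n r => (r + m) ^ k * (f r - f (n + 1)) ^ 2) (fun n => by fun_prop) ?_ fun n => ?_
  · intro x hx
    filter_upwards [tendsto_one_div_add_atTop_nhds_zero_nat.eventually (gt_mem_nhds (mem_Ioi.1 hx)),
      htop.eventually_ge_atTop x] with n h1 h2 using ⟨h1.le, h2⟩
  · intro x _
    have : Tendsto (fun n : ℕ => (x + m) ^ k * (f x - f (n + 1)) ^ 2) atTop
        (𝓝 ((x + m) ^ k * (f x - 0) ^ 2)) :=
      ((tendsto_const_nhds.sub (hlim.comp htop)).pow 2).const_mul _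
    simpa using this
  · refine le_trans ?_ (lintegral_mono_set (hKs n))
    set c := f (n + 1)
    have h1n : (1 : ℝ) ≤ n + 1 := by linarith [Nat.cast_nonneg (α := ℝ) n]
    refine lintegral_Icc_le_of_le_add_deriv
      (F := fun r => 2 * (r * (r + m) ^ k * (f r - c) ^ 2))
      (F' := fun r => 2 * ((1 * (r + m) ^ k + r * (k * (r + m) ^ (k - 1) * 1)) * (f r - c) ^ 2
        + r * (r + m) ^ k * (2 * (f r - c) * f' r))) ?_ ?_ ?_ ?_ ?_ ?_ ?_ ?_
    · exact (div_le_one (by positivity)).2 h1n |>.trans h1n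
    · have := hfc.mono (hKs n); fun_prop
    · have := hf'.mono (hKs n); fun_prop
    · intro x hx
      have : 0 < x := hKs n hx
      positivity
    · intro x hx
      have : 0 < x := hKs n hx
      positivity
    · intro x hx
      have e1 : HasDerivAt (fun r : ℝ => r + m) 1 x := (hasDerivAt_id x).add_const m
      have e2 := (((hasDerivAt_id x).mul (e1.pow k)).mul
        (((hf x (hKs n hx)).sub_const c).pow 2)).const_mul 2
      refine e2.congr_deriv ?_
      simp
    · intro x hx
      have hx0 : 0 < x := hKs n hx
      -- Q + F' − P is exactly this square plus 2 times the nonnegative term `a2`.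
      have a1 : 0 ≤ (x + m) ^ k * ((f x - c) + 2 * x * f' x) ^ 2 := by positivity
      have a2 : 0 ≤ x * (k * (x + m) ^ (k - 1) * 1) * (f x - c) ^ 2 := by positivity
      nlinarith
    · have : 0 < 1 / ((n : ℝ) + 1) := by positivity
      simp only [c, sub_self]
      norm_num
      positivity

/-- The weight improves from cos⁵ to cos³ at the ends, at the price of a zeroth-order term. The
multiplier −½ sin φ cos⁴φ f² is nonpositive at b and nonnegative at −b, so f need not vanish at the
ends. -/
theorem hardy_angular {f f' : ℝ → ℝ}
    (hf : ∀ φ ∈ Ioo (-(Real.pi / 2)) (Real.pi / 2), HasDerivAt f (f' φ) φ)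
    (hf' : ContinuousOn f' (Ioo (-(Real.pi / 2)) (Real.pi / 2))) :
    ∫⁻ φ in Ioo (-(Real.pi / 2)) (Real.pi / 2), ENNReal.ofReal (Real.cos φ ^ 3 * f φ ^ 2) ≤
      ∫⁻ φ in Ioo (-(Real.pi / 2)) (Real.pi / 2),
        ENNReal.ofReal (Real.cos φ ^ 5 * (2 * f φ ^ 2 + f' φ ^ 2)) := by
  set S := Ioo (-(Real.pi / 2)) (Real.pi / 2)
  have hfc : ContinuousOn f S := fun r hr => (hf r hr).continuousAt.continuousWithinAt
  have hp : (3 : ℝ) < Real.pi := Real.pi_gt_three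
  have hn : ∀ n : ℕ, 0 < 1 / ((n : ℝ) + 1) ∧ 1 / ((n : ℝ) + 1) ≤ 1 := fun n =>
    ⟨by positivity, (div_le_one (by positivity)).2 (by linarith [Nat.cast_nonneg (α := ℝ) n])⟩
  have hKs : ∀ n : ℕ,
      Icc (-(Real.pi / 2 - 1 / ((n : ℝ) + 1))) (Real.pi / 2 - 1 / ((n : ℝ) + 1)) ⊆ S :=
    fun n x hx => ⟨by linarith [hx.1, hn n], by linarith [hx.2, hn n]⟩
  refine lintegral_le_of_exhaustion measurableSet_Ioo (fun n => measurableSet_Icc) hKs ?_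
    (Pn := fun _ φ => Real.cos φ ^ 3 * f φ ^ 2) (fun n => by fun_prop)
    (fun x _ => tendsto_const_nhds) fun n => ?_
  · intro x hx
    have h1 : 0 < Real.pi / 2 - x := by linarith [hx.2]
    have h2 : 0 < Real.pi / 2 + x := by linarith [hx.1]
    filter_upwards [tendsto_one_div_add_atTop_nhds_zero_nat.eventually (gt_mem_nhds h1),
      tendsto_one_div_add_atTop_nhds_zero_nat.eventually (gt_mem_nhds h2)] with n h1 h2
    constructor <;> linarith
  · refine le_trans ?_ (lintegral_mono_set (hKs n))
    set b := Real.pi / 2 - 1 / ((n : ℝ) + 1) with hb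
    have hb0 : 0 ≤ b := by linarith [hn n]
    have hsin : 0 ≤ Real.sin b :=
      Real.sin_nonneg_of_nonneg_of_le_pi hb0 (by linarith [hn n])
    have hcos : ∀ x ∈ Icc (-b) b, 0 < Real.cos x := fun x hx => Real.cos_pos_of_mem_Ioo (hKs n hx)
    refine lintegral_Icc_le_of_le_add_deriv
      (F := fun φ => -(1 / 2) * (Real.sin φ * Real.cos φ ^ 4 * f φ ^ 2))
      (F' := fun φ => -(1 / 2) * ((Real.cos φ * Real.cos φ ^ 4
        + Real.sin φ * (4 * Real.cos φ ^ 3 * -Real.sin φ)) * f φ ^ 2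
        + Real.sin φ * Real.cos φ ^ 4 * (2 * f φ * f' φ))) (by linarith) ?_ ?_ ?_ ?_ ?_ ?_ ?_
    · have := hfc.mono (hKs n); fun_prop
    · have := hfc.mono (hKs n); have := hf'.mono (hKs n); fun_prop
    · intro x hx
      have := hcos x hx
      positivity
    · intro x hx
      have := hcos x hx
      positivity
    · intro x hx
      have e2 := (((Real.hasDerivAt_sin x).mul ((Real.hasDerivAt_cos x).pow 4)).mul
        ((hf x (hKs n hx)).pow 2)).const_mul (-(1 / 2))
      refine e2.congr_deriv ?_
      simp
    · intro x hx
      have hc := hcos x hx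
      -- Once cos³ f² is multiplied by sin² + cos² = 1, Q + F' − P equals this sum of squares.
      have a1 : 0 ≤ Real.cos x ^ 3 * (1 / 2 * (Real.cos x * f x) ^ 2
        + 1 / 2 * (Real.cos x * f' x) ^ 2 + 1 / 2 * (Real.sin x * f x) ^ 2
        + 1 / 2 * (Real.cos x * f' x - Real.sin x * f x) ^ 2) := by positivity
      have e3 : Real.cos x ^ 3 * f x ^ 2 =
          Real.cos x ^ 3 * (Real.sin x ^ 2 + Real.cos x ^ 2) * f x ^ 2 := by
        rw [Real.sin_sq_add_cos_sq]; ring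
      rw [e3]
      nlinarith
    · simp only [Real.sin_neg, Real.cos_neg]
      have a1 : 0 ≤ Real.sin b * Real.cos b ^ 4 * f b ^ 2 := by positivity
      have a2 : 0 ≤ Real.sin b * Real.cos b ^ 4 * f (-b) ^ 2 := by positivity
      linarith

end OneDimensional

/-! ### Polar coordinates and Hardy inequalities on the half plane -/

section HalfPlane

theorem isOpen_halfPlane : IsOpen halfPlane := isOpen_lt continuous_const continuous_fst

theorem measurableSet_halfPlane : MeasurableSet halfPlane := isOpen_halfPlane.measurableSet

/-- Chain rule in terms of `dRho` and `dZ`, for differentiating along rays and circles: both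
partials are values of the Fréchet derivative, which is linear. -/
theorem hasDerivAt_comp_curve {g : ℝ → ℝ → ℝ} {X Y : ℝ → ℝ} {x X' Y' : ℝ}
    (hg : DifferentiableAt ℝ (fun x : ℝ × ℝ => g x.1 x.2) (X x, Y x))
    (hX : HasDerivAt X X' x) (hY : HasDerivAt Y Y' x) :
    HasDerivAt (fun s => g (X s) (Y s)) (dRho g (X x) (Y x) * X' + dZ g (X x) (Y x) * Y') x := by
  set L := fderiv ℝ (fun x : ℝ × ℝ => g x.1 x.2) (X x, Y x)
  have key : ∀ {X Y : ℝ → ℝ} {x X' Y' : ℝ} {p : ℝ × ℝ}, p = (X x, Y x) →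
      HasFDerivAt (fun x : ℝ × ℝ => g x.1 x.2) L p → HasDerivAt X X' x → HasDerivAt Y Y' x →
      HasDerivAt (fun s => g (X s) (Y s)) (L (X', Y')) x := by
    intro X Y x X' Y' p hp hL hX hY
    subst hp
    exact hL.comp_hasDerivAt x (hX.prodMk hY)
  have h1 : dRho g (X x) (Y x) = L (1, 0) :=
    (key (X := fun s => s) (Y := fun _ => Y x) rfl hg.hasFDerivAt (hasDerivAt_id' _)
      (hasDerivAt_const _ _)).deriv
  have h2 : dZ g (X x) (Y x) = L (0, 1) :=
    (key (X := fun _ => X x) (Y := fun s => s) rfl hg.hasFDerivAt (hasDerivAt_const _ _)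
      (hasDerivAt_id' _)).deriv
  convert! key rfl hg.hasFDerivAt hX hY using 1
  rw [h1, h2, mul_comm, mul_comm (L (0, 1)), ← smul_eq_mul, ← smul_eq_mul, ← map_smul, ← map_smul,
    ← map_add]
  simp

variable {g : ℝ → ℝ → ℝ}

theorem differentiableAt_of_contDiffOn
    (hg : ContDiffOn ℝ 2 (fun x : ℝ × ℝ => g x.1 x.2) halfPlane) {ρ z : ℝ} (hρ : 0 < ρ) :
    DifferentiableAt ℝ (fun x : ℝ × ℝ => g x.1 x.2) (ρ, z) :=
  (hg.contDiffAt (isOpen_halfPlane.mem_nhds hρ)).differentiableAt (by simp)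

theorem continuousOn_dRho (hg : ContDiffOn ℝ 2 (fun x : ℝ × ℝ => g x.1 x.2) halfPlane) :
    ContinuousOn (fun x : ℝ × ℝ => dRho g x.1 x.2) halfPlane := by
  have h1 := (hg.continuousOn_fderiv_of_isOpen isOpen_halfPlane (by simp)).clm_apply
    (continuousOn_const (c := ((1 : ℝ), (0 : ℝ))))
  refine h1.congr fun x hx => ?_
  exact ((differentiableAt_of_contDiffOn hg hx).hasFDerivAt.comp_hasDerivAt
    (f := fun s => (s, x.2)) x.1
    ((hasDerivAt_id' x.1).prodMk (hasDerivAt_const x.1 x.2))).deriv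

theorem continuousOn_dZ (hg : ContDiffOn ℝ 2 (fun x : ℝ × ℝ => g x.1 x.2) halfPlane) :
    ContinuousOn (fun x : ℝ × ℝ => dZ g x.1 x.2) halfPlane := by
  have h1 := (hg.continuousOn_fderiv_of_isOpen isOpen_halfPlane (by simp)).clm_apply
    (continuousOn_const (c := ((0 : ℝ), (1 : ℝ))))
  refine h1.congr fun x hx => ?_
  exact ((differentiableAt_of_contDiffOn hg hx).hasFDerivAt.comp_hasDerivAt
    (f := fun s => (x.1, s)) x.2
    ((hasDerivAt_const x.2 x.1).prodMk (hasDerivAt_id' x.2))).deriv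

theorem continuousOn_gradSq (hg : ContDiffOn ℝ 2 (fun x : ℝ × ℝ => g x.1 x.2) halfPlane) :
    ContinuousOn (fun x : ℝ × ℝ => gradSq g x.1 x.2) halfPlane :=
  ((continuousOn_dRho hg).pow 2).add ((continuousOn_dZ hg).pow 2)

/-- The half plane in polar coordinates `(r, φ)`, where `φ = π / 2 - θ` is the latitude. -/
def polarStrip : Set (ℝ × ℝ) := Ioi 0 ×ˢ Ioo (-(Real.pi / 2)) (Real.pi / 2)

theorem polarStrip_mapsTo :
    MapsTo (fun p : ℝ × ℝ => (p.1 * Real.cos p.2, p.1 * Real.sin p.2)) polarStrip halfPlane :=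
  fun _ hp => mul_pos hp.1 (Real.cos_pos_of_mem_Ioo hp.2)

/-- Polar coordinates with angles in (−π, π): the half plane is the part where cos φ > 0, that is
|φ| < π/2. -/
theorem lintegral_halfPlane_eq_polarStrip (g : ℝ → ℝ → ℝ) :
    ∫⁻ x in halfPlane, ENNReal.ofReal (g x.1 x.2) =
      ∫⁻ p in polarStrip, ENNReal.ofReal (p.1 * g (p.1 * Real.cos p.2) (p.1 * Real.sin p.2)) := by
  have hS : MeasurableSet polarStrip := measurableSet_Ioi.prod measurableSet_Ioo
  have hsub : polarStrip ⊆ polarCoord.target := fun p hp =>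
    ⟨hp.1, by linarith [hp.2.1, Real.pi_pos], by linarith [hp.2.2, Real.pi_pos]⟩
  rw [← lintegral_indicator measurableSet_halfPlane, ← lintegral_comp_polarCoord_symm]
  calc _ = ∫⁻ p in polarCoord.target, polarStrip.indicator (fun p => ENNReal.ofReal
        (p.1 * g (p.1 * Real.cos p.2) (p.1 * Real.sin p.2))) p := by
        refine setLIntegral_congr_fun polarCoord.open_target.measurableSet fun p hp => ?_
        have hp1 : 0 < p.1 := hp.1
        by_cases h : p ∈ polarStrip
        · have h' : polarCoord.symm p ∈ halfPlane := polarStrip_mapsTo h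
          rw [indicator_of_mem h, indicator_of_mem h', ENNReal.ofReal_mul hp1.le]
          rfl
        · have h' : polarCoord.symm p ∉ halfPlane := by
            intro h'
            have hc : 0 < p.1 * Real.cos p.2 := h'
            have hc' : 0 < Real.cos p.2 := by
              by_contra hcon
              nlinarith
            refine h ⟨hp1, ?_, ?_⟩
            · by_contra hcon
              push Not at hcon
              have := Real.cos_nonpos_of_pi_div_two_le_of_le (x := -p.2) (by linarith)
                (by linarith [hp.2.1, Real.pi_pos])
              rw [Real.cos_neg] at this
              linarith
            · by_contra hcon
              push Not at hcon
              have := Real.cos_nonpos_of_pi_div_two_le_of_le hcon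
                (by linarith [hp.2.2, Real.pi_pos])
              linarith
          rw [indicator_of_notMem h, indicator_of_notMem h', smul_zero]
    _ = _ := by rw [setLIntegral_indicator hS, inter_eq_left.2 hsub]

theorem aemeasurable_polar (hg : ContinuousOn (fun x : ℝ × ℝ => g x.1 x.2) halfPlane) :
    AEMeasurable (fun p : ℝ × ℝ =>
      ENNReal.ofReal (p.1 * g (p.1 * Real.cos p.2) (p.1 * Real.sin p.2)))
      ((volume.prod volume).restrict polarStrip) := by
  have hS : MeasurableSet polarStrip := measurableSet_Ioi.prod measurableSet_Ioo
  refine (ContinuousOn.aemeasurable ?_ hS).ennreal_ofReal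
  refine continuousOn_fst.mul ?_
  exact hg.comp (f := fun p : ℝ × ℝ => (p.1 * Real.cos p.2, p.1 * Real.sin p.2))
    (by fun_prop) polarStrip_mapsTo

theorem lintegral_halfPlane_polar (hg : ContinuousOn (fun x : ℝ × ℝ => g x.1 x.2) halfPlane) :
    ∫⁻ x in halfPlane, ENNReal.ofReal (g x.1 x.2) =
      ∫⁻ φ in Ioo (-(Real.pi / 2)) (Real.pi / 2), ∫⁻ r in Ioi (0 : ℝ),
        ENNReal.ofReal (r * g (r * Real.cos φ) (r * Real.sin φ)) := by
  rw [lintegral_halfPlane_eq_polarStrip]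
  exact setLIntegral_prod_symm _ (aemeasurable_polar hg)

theorem lintegral_halfPlane_polar' (hg : ContinuousOn (fun x : ℝ × ℝ => g x.1 x.2) halfPlane) :
    ∫⁻ x in halfPlane, ENNReal.ofReal (g x.1 x.2) =
      ∫⁻ r in Ioi (0 : ℝ), ∫⁻ φ in Ioo (-(Real.pi / 2)) (Real.pi / 2),
        ENNReal.ofReal (r * g (r * Real.cos φ) (r * Real.sin φ)) := by
  rw [lintegral_halfPlane_eq_polarStrip]
  exact setLIntegral_prod _ (aemeasurable_polar hg)

theorem rad_polar {r : ℝ} (hr : 0 ≤ r) (φ : ℝ) : rad (r * Real.cos φ) (r * Real.sin φ) = r := by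
  rw [rad, show (r * Real.cos φ) ^ 2 + (r * Real.sin φ) ^ 2
    = r ^ 2 * (Real.sin φ ^ 2 + Real.cos φ ^ 2) by ring, Real.sin_sq_add_cos_sq, mul_one,
    Real.sqrt_sq hr]

theorem sinTheta_polar {r : ℝ} (hr : 0 < r) (φ : ℝ) :
    sinTheta (r * Real.cos φ) (r * Real.sin φ) = Real.cos φ := by
  rw [sinTheta, rad_polar hr.le]; field_simp

theorem continuousOn_rad : ContinuousOn (fun x : ℝ × ℝ => rad x.1 x.2) halfPlane := by
  unfold rad; fun_prop

theorem continuousOn_sinTheta : ContinuousOn (fun x : ℝ × ℝ => sinTheta x.1 x.2) halfPlane :=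
  continuousOn_fst.div continuousOn_rad fun _ hx => (rad_pos hx).ne'

theorem continuousOn_hardy_left {m : ℝ} (k j : ℕ)
    (hg : ContDiffOn ℝ 2 (fun x : ℝ × ℝ => g x.1 x.2) halfPlane) :
    ContinuousOn (fun x : ℝ × ℝ => (rad x.1 x.2 + m) ^ k * sinTheta x.1 x.2 ^ j
      * (g x.1 x.2 ^ 2 / rad x.1 x.2 ^ 2) * x.1) halfPlane := by
  have h1 := continuousOn_rad
  have h2 := continuousOn_sinTheta
  have h3 := hg.continuousOn
  exact ((((h1.add continuousOn_const).pow k).mul (h2.pow j)).mul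
    ((h3.pow 2).div (h1.pow 2) fun _ hx => (pow_pos (rad_pos hx) 2).ne')).mul continuousOn_fst

theorem continuousOn_hardy_right {m : ℝ} (k j : ℕ)
    (hg : ContDiffOn ℝ 2 (fun x : ℝ × ℝ => g x.1 x.2) halfPlane) :
    ContinuousOn (fun x : ℝ × ℝ => (rad x.1 x.2 + m) ^ k * sinTheta x.1 x.2 ^ j
      * gradSq g x.1 x.2 * x.1) halfPlane := by
  have h1 := continuousOn_rad
  have h2 := continuousOn_sinTheta
  have h3 := continuousOn_gradSq hg
  exact ((((h1.add continuousOn_const).pow k).mul (h2.pow j)).mul h3).mul continuousOn_fst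

/-- Hardy's inequality along the rays from the horizon. -/
theorem hardy_halfPlane_radial {m : ℝ} (hm : 0 ≤ m) (k j : ℕ)
    (hg : ContDiffOn ℝ 2 (fun x : ℝ × ℝ => g x.1 x.2) halfPlane)
    (hlim : ∀ φ ∈ Ioo (-(Real.pi / 2)) (Real.pi / 2),
      Tendsto (fun r => g (r * Real.cos φ) (r * Real.sin φ)) atTop (𝓝 0)) :
    ∫⁻ x in halfPlane, ENNReal.ofReal ((rad x.1 x.2 + m) ^ k * sinTheta x.1 x.2 ^ j
      * (g x.1 x.2 ^ 2 / rad x.1 x.2 ^ 2) * x.1) ≤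
    ∫⁻ x in halfPlane, ENNReal.ofReal (4 * ((rad x.1 x.2 + m) ^ k * sinTheta x.1 x.2 ^ j
      * gradSq g x.1 x.2 * x.1)) := by
  rw [lintegral_halfPlane_polar (g := fun ρ z => (rad ρ z + m) ^ k * sinTheta ρ z ^ j
      * (g ρ z ^ 2 / rad ρ z ^ 2) * ρ) (continuousOn_hardy_left k j hg),
    lintegral_halfPlane_polar (g := fun ρ z => 4 * ((rad ρ z + m) ^ k * sinTheta ρ z ^ j
      * gradSq g ρ z * ρ)) (continuousOn_const.mul (continuousOn_hardy_right k j hg))]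
  refine setLIntegral_mono' measurableSet_Ioo fun φ hφ => ?_
  have hc : 0 < Real.cos φ := Real.cos_pos_of_mem_Ioo hφ
  set c := Real.cos φ
  set s := Real.sin φ
  have hcs : s ^ 2 + c ^ 2 = 1 := Real.sin_sq_add_cos_sq φ
  have hmaps : MapsTo (fun r : ℝ => (r * c, r * s)) (Ioi 0) halfPlane := fun r hr => mul_pos hr hc
  have H := hardy_radial hm k (f := fun r => g (r * c) (r * s))
    (f' := fun r => dRho g (r * c) (r * s) * c + dZ g (r * c) (r * s) * s) ?_ ?_ (hlim φ hφ)
  -- The Jacobian r and the factor ρ = r c give r² c; the r² cancels the Hardy weight 1/r², and the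
  -- power of c is constant along the ray.
  · calc _ = ∫⁻ r in Ioi (0 : ℝ), ENNReal.ofReal (c ^ (j + 1))
          * ENNReal.ofReal ((r + m) ^ k * g (r * c) (r * s) ^ 2) := by
          refine setLIntegral_congr_fun measurableSet_Ioi fun r hr => ?_
          have hr0 : 0 < r := hr
          rw [← ENNReal.ofReal_mul (by positivity)]
          rw [rad_polar hr0.le, sinTheta_polar hr0]
          congr 1
          field_simp
          ring
      _ = ENNReal.ofReal (c ^ (j + 1))
          * ∫⁻ r in Ioi (0 : ℝ), ENNReal.ofReal ((r + m) ^ k * g (r * c) (r * s) ^ 2) :=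
          lintegral_const_mul' _ _ ENNReal.ofReal_ne_top
      _ ≤ _ := mul_le_mul_right H _
      _ = _ := (lintegral_const_mul' _ _ ENNReal.ofReal_ne_top).symm
      _ ≤ _ := by
          refine setLIntegral_mono' measurableSet_Ioi fun r hr => ?_
          have hr0 : 0 < r := hr
          rw [← ENNReal.ofReal_mul (by positivity)]
          rw [rad_polar hr0.le, sinTheta_polar hr0]
          refine ENNReal.ofReal_le_ofReal ?_
          have hcs' : (dRho g (r * c) (r * s) * c + dZ g (r * c) (r * s) * s) ^ 2
              ≤ gradSq g (r * c) (r * s) := by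
            set a := dRho g (r * c) (r * s)
            set b := dZ g (r * c) (r * s)
            have : gradSq g (r * c) (r * s) = (a ^ 2 + b ^ 2) * (s ^ 2 + c ^ 2) := by
              rw [hcs, mul_one]; rfl
            rw [this]; nlinarith [sq_nonneg (a * s - b * c)]
          calc _ ≤ c ^ (j + 1) * (4 * ((r + m) ^ k * (r ^ 2 * gradSq g (r * c) (r * s)))) := by
                gcongr
            _ = _ := by ring
  · intro r hr
    have := hasDerivAt_comp_curve (g := g) (X := fun r => r * c) (Y := fun r => r * s)
      (differentiableAt_of_contDiffOn hg (hmaps hr)) ((hasDerivAt_id' r).mul_const c)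
      ((hasDerivAt_id' r).mul_const s)
    simpa using this
  · have h1 := (continuousOn_dRho hg).comp (f := fun r : ℝ => (r * c, r * s)) (by fun_prop) hmaps
    have h2 := (continuousOn_dZ hg).comp (f := fun r : ℝ => (r * c, r * s)) (by fun_prop) hmaps
    exact (h1.mul continuousOn_const).add (h2.mul continuousOn_const)

/-- Hardy's inequality along the circles around the horizon. -/
theorem hardy_halfPlane_angular {m : ℝ} (hm : 0 ≤ m) (k : ℕ)
    (hg : ContDiffOn ℝ 2 (fun x : ℝ × ℝ => g x.1 x.2) halfPlane) :
    ∫⁻ x in halfPlane, ENNReal.ofReal ((rad x.1 x.2 + m) ^ k * sinTheta x.1 x.2 ^ 2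
      * (g x.1 x.2 ^ 2 / rad x.1 x.2 ^ 2) * x.1) ≤
    ∫⁻ x in halfPlane, ENNReal.ofReal (2 * ((rad x.1 x.2 + m) ^ k * sinTheta x.1 x.2 ^ 4
        * (g x.1 x.2 ^ 2 / rad x.1 x.2 ^ 2) * x.1)
      + (rad x.1 x.2 + m) ^ k * sinTheta x.1 x.2 ^ 4 * gradSq g x.1 x.2 * x.1) := by
  rw [lintegral_halfPlane_polar' (g := fun ρ z => (rad ρ z + m) ^ k * sinTheta ρ z ^ 2
      * (g ρ z ^ 2 / rad ρ z ^ 2) * ρ) (continuousOn_hardy_left k 2 hg),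
    lintegral_halfPlane_polar' (g := fun ρ z => 2 * ((rad ρ z + m) ^ k * sinTheta ρ z ^ 4
        * (g ρ z ^ 2 / rad ρ z ^ 2) * ρ)
      + (rad ρ z + m) ^ k * sinTheta ρ z ^ 4 * gradSq g ρ z * ρ)
      ((continuousOn_const.mul (continuousOn_hardy_left k 4 hg)).add
        (continuousOn_hardy_right k 4 hg))]
  refine setLIntegral_mono' measurableSet_Ioi fun r hr => ?_
  have hr0 : 0 < r := hr
  have hmaps : MapsTo (fun φ : ℝ => (r * Real.cos φ, r * Real.sin φ))
      (Ioo (-(Real.pi / 2)) (Real.pi / 2)) halfPlane :=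
    fun φ hφ => mul_pos hr0 (Real.cos_pos_of_mem_Ioo hφ)
  have H := hardy_angular (f := fun φ => g (r * Real.cos φ) (r * Real.sin φ))
    (f' := fun φ => dRho g (r * Real.cos φ) (r * Real.sin φ) * (r * -Real.sin φ)
      + dZ g (r * Real.cos φ) (r * Real.sin φ) * (r * Real.cos φ)) ?_ ?_
  · calc _ = ∫⁻ φ in Ioo (-(Real.pi / 2)) (Real.pi / 2), ENNReal.ofReal ((r + m) ^ k)
          * ENNReal.ofReal (Real.cos φ ^ 3 * g (r * Real.cos φ) (r * Real.sin φ) ^ 2) := by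
          refine setLIntegral_congr_fun measurableSet_Ioo fun φ hφ => ?_
          rw [← ENNReal.ofReal_mul (by positivity)]
          rw [rad_polar hr0.le, sinTheta_polar hr0]
          congr 1
          field_simp
      _ = _ := lintegral_const_mul' _ _ ENNReal.ofReal_ne_top
      _ ≤ _ := mul_le_mul_right H _
      _ = _ := (lintegral_const_mul' _ _ ENNReal.ofReal_ne_top).symm
      _ ≤ _ := by
          refine setLIntegral_mono' measurableSet_Ioo fun φ hφ => ?_
          have hc : 0 < Real.cos φ := Real.cos_pos_of_mem_Ioo hφ
          rw [← ENNReal.ofReal_mul (by positivity)]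
          rw [rad_polar hr0.le, sinTheta_polar hr0]
          refine ENNReal.ofReal_le_ofReal ?_
          set c := Real.cos φ
          set s := Real.sin φ
          have hcs : s ^ 2 + c ^ 2 = 1 := Real.sin_sq_add_cos_sq φ
          -- The tangential derivative with respect to φ is at most r |∂g|.
          have hcs' : (dRho g (r * c) (r * s) * (r * -s) + dZ g (r * c) (r * s) * (r * c)) ^ 2
              ≤ r ^ 2 * gradSq g (r * c) (r * s) := by
            set a := dRho g (r * c) (r * s)
            set b := dZ g (r * c) (r * s)
            have : gradSq g (r * c) (r * s) = (a ^ 2 + b ^ 2) * (s ^ 2 + c ^ 2) := by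
              rw [hcs, mul_one]; rfl
            rw [this]; nlinarith [sq_nonneg (r * (a * c + b * s))]
          calc _ ≤ (r + m) ^ k * (c ^ 5 * (2 * g (r * c) (r * s) ^ 2
                + r ^ 2 * gradSq g (r * c) (r * s))) := by gcongr
            _ = _ := by field_simp
  · intro φ hφ
    exact hasDerivAt_comp_curve (g := g) (X := fun φ => r * Real.cos φ)
      (Y := fun φ => r * Real.sin φ) (differentiableAt_of_contDiffOn hg (hmaps hφ))
      ((Real.hasDerivAt_cos φ).const_mul r) ((Real.hasDerivAt_sin φ).const_mul r)
  · have h1 := (continuousOn_dRho hg).comp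
      (f := fun φ : ℝ => (r * Real.cos φ, r * Real.sin φ)) (by fun_prop) hmaps
    have h2 := (continuousOn_dZ hg).comp
      (f := fun φ : ℝ => (r * Real.cos φ, r * Real.sin φ)) (by fun_prop) hmaps
    exact (h1.mul (by fun_prop)).add (h2.mul (by fun_prop))

end HalfPlane

/-! ### Scale-invariant bounds for the derivatives of the background -/

section Background

/-- Scale-invariant bounds for the first derivatives of `η₀`, `ω₀`, `σ₀` and for `³Δ σ₀`. -/
theorem exists_background_bound : ∃ A : ℝ, 0 < A ∧ ∀ {m ρ z : ℝ}, 0 < m → 0 < ρ →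
    gradSq (eta0 m) ρ z * rad ρ z ^ 2 ≤ A * ((rad ρ z + m) ^ 4 * sinTheta ρ z ^ 2) ∧
    gradSq (omega0 m) ρ z * rad ρ z ^ 2 ≤ A * eta0 m ρ z ^ 2 ∧
    gradSq (sigma0 m) ρ z * rad ρ z ^ 2 ≤ A ∧
    sinTheta ρ z ^ 2 * lap3 (sigma0 m) ρ z ^ 2 * rad ρ z ^ 4 ≤ A := by
  obtain ⟨K1, hK1, h1⟩ := CoordLine.exists_deriv_eta0
  obtain ⟨K2, hK2, h2⟩ := CoordLine.exists_deriv_omega0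
  obtain ⟨K3, hK3, h3⟩ := CoordLine.exists_deriv_sigma0
  -- The 2 comes from the two components of a gradient, 8 = 2 · 2² from m² sin²θ ≤ 2 η₀, and 9 = 3²
  -- from the three terms of ³Δσ₀.
  refine ⟨2 * K1 ^ 2 + 8 * K2 ^ 2 + 9 * K3 ^ 2, by positivity, fun {m ρ z} hm hρ => ?_⟩
  have hr := rad_pos (z := z) hρ
  have hs := sinTheta_pos (z := z) hρ
  have hs1 := sinTheta_le_one (z := z) hρ
  have hη := eta0_pos (z := z) hm hρ
  have lρ := coordLine_rho (z := z) hρ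
  have lz := coordLine_z (z := z) hρ
  have e1 : |dRho (eta0 m) ρ z| * rad ρ z ≤ K1 * ((rad ρ z + m) ^ 2 * sinTheta ρ z) :=
    h1 lρ hm
  have e2 : |dZ (eta0 m) ρ z| * rad ρ z ≤ K1 * ((rad ρ z + m) ^ 2 * sinTheta ρ z) := h1 lz hm
  have w1 : |dRho (omega0 m) ρ z| * rad ρ z ≤ K2 * m ^ 2 * sinTheta ρ z ^ 2 := h2 lρ hm
  have w2 : |dZ (omega0 m) ρ z| * rad ρ z ≤ K2 * m ^ 2 * sinTheta ρ z ^ 2 := h2 lz hm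
  have s1 : |dRho (sigma0 m) ρ z| * rad ρ z ≤ K3 := (h3 lρ hm).2.1
  have s2 : |dZ (sigma0 m) ρ z| * rad ρ z ≤ K3 := (h3 lz hm).2.1
  have t1 : |dRho (dRho (sigma0 m)) ρ z| * rad ρ z ^ 2 ≤ K3 := (h3 lρ hm).2.2
  have t2 : |dZ (dZ (sigma0 m)) ρ z| * rad ρ z ^ 2 ≤ K3 := (h3 lz hm).2.2
  have sq_le : ∀ {a b c d : ℝ}, |a| * c ≤ d → |b| * c ≤ d → 0 ≤ c → (a ^ 2 + b ^ 2) * c ^ 2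
      ≤ 2 * d ^ 2 := by
    intro a b c d ha hb hc
    have i1 := pow_le_pow_left₀ (by positivity) ha 2
    have i2 := pow_le_pow_left₀ (by positivity) hb 2
    rw [mul_pow, sq_abs] at i1 i2
    linarith
  have hK1' : 0 ≤ K1 ^ 2 := by positivity
  have hK2' : 0 ≤ K2 ^ 2 := by positivity
  have hK3' : 0 ≤ K3 ^ 2 := by positivity
  refine ⟨?_, ?_, ?_, ?_⟩
  · refine (sq_le e1 e2 hr.le).trans ?_
    have : 0 ≤ (rad ρ z + m) ^ 4 * sinTheta ρ z ^ 2 := by positivity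
    calc _ = 2 * K1 ^ 2 * ((rad ρ z + m) ^ 4 * sinTheta ρ z ^ 2) := by ring
      _ ≤ _ := by gcongr; linarith
  · refine (sq_le w1 w2 hr.le).trans ?_
    have hms : m ^ 2 * sinTheta ρ z ^ 2 ≤ 2 * eta0 m ρ z := by
      refine le_trans ?_ (le_eta0 hm hρ)
      gcongr; linarith
    calc _ = 2 * K2 ^ 2 * (m ^ 2 * sinTheta ρ z ^ 2) ^ 2 := by ring
      _ ≤ 2 * K2 ^ 2 * (2 * eta0 m ρ z) ^ 2 := by gcongr
      _ = 8 * K2 ^ 2 * eta0 m ρ z ^ 2 := by ring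
      _ ≤ _ := by gcongr; linarith
  · refine (sq_le s1 s2 hr.le).trans ?_
    linarith
  -- The term ∂_ρ σ₀ / ρ is only of order 1/(r ρ); the factor sin θ = ρ/r turns this into 1/r².
  · have hs3 : sinTheta ρ z * |dRho (sigma0 m) ρ z / ρ| * rad ρ z ^ 2 ≤ K3 := by
      refine le_trans (le_of_eq ?_) s1
      rw [abs_div, abs_of_pos hρ, sinTheta]; field_simp
    have hs4 : sinTheta ρ z * |lap3 (sigma0 m) ρ z| * rad ρ z ^ 2 ≤ 3 * K3 := by
      have := abs_add_three (dRho (dRho (sigma0 m)) ρ z) (dZ (dZ (sigma0 m)) ρ z)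
        (dRho (sigma0 m) ρ z / ρ)
      calc _ ≤ sinTheta ρ z * (|dRho (dRho (sigma0 m)) ρ z| + |dZ (dZ (sigma0 m)) ρ z|
            + |dRho (sigma0 m) ρ z / ρ|) * rad ρ z ^ 2 := by gcongr; exact this
        _ = sinTheta ρ z * (|dRho (dRho (sigma0 m)) ρ z| * rad ρ z ^ 2)
            + sinTheta ρ z * (|dZ (dZ (sigma0 m)) ρ z| * rad ρ z ^ 2)
            + sinTheta ρ z * |dRho (sigma0 m) ρ z / ρ| * rad ρ z ^ 2 := by ring
        _ ≤ 1 * K3 + 1 * K3 + K3 := by gcongr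
        _ = _ := by ring
    have := pow_le_pow_left₀ (by positivity) hs4 2
    calc _ = (sinTheta ρ z * |lap3 (sigma0 m) ρ z| * rad ρ z ^ 2) ^ 2 := by
          rw [mul_pow, mul_pow, sq_abs]; ring
      _ ≤ (3 * K3) ^ 2 := this
      _ ≤ _ := by linarith

theorem contDiffOn_eta0 {m : ℝ} (hm : 0 < m) :
    ContDiffOn ℝ 2 (fun x : ℝ × ℝ => eta0 m x.1 x.2) halfPlane := by
  have hr : ContDiffOn ℝ 2 (fun x : ℝ × ℝ => rad x.1 x.2) halfPlane := by
    unfold rad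
    refine ContDiffOn.sqrt (by fun_prop) fun x hx => ?_
    have : 0 < x.1 := hx
    positivity
  have hr0 : ∀ x ∈ halfPlane, rad x.1 x.2 ≠ 0 := fun x hx => (rad_pos hx).ne'
  have hs : ContDiffOn ℝ 2 (fun x : ℝ × ℝ => sinTheta x.1 x.2) halfPlane :=
    contDiffOn_fst.div hr hr0
  have hc : ContDiffOn ℝ 2 (fun x : ℝ × ℝ => cosTheta x.1 x.2) halfPlane :=
    contDiffOn_snd.div hr hr0
  have hS : ContDiffOn ℝ 2 (fun x : ℝ × ℝ => kerrSigma m x.1 x.2) halfPlane := by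
    unfold kerrSigma; fun_prop
  have hN : ContDiffOn ℝ 2 (fun x : ℝ × ℝ => kerrN m x.1 x.2) halfPlane := by
    unfold kerrN; fun_prop
  exact (hN.div hS fun x hx => (kerrSigma_pos hm hx).ne').mul (hs.pow 2)

theorem eta0_eq_mul_exp {m ρ z : ℝ} (hm : 0 < m) (hρ : 0 < ρ) :
    eta0 m ρ z = ρ ^ 2 * Real.exp (sigma0 m ρ z) := by
  have := eta0_pos (z := z) hm hρ
  rw [sigma0, Real.exp_log (by positivity)]
  field_simp

end Background

/-! ### Conjugating the twist equation by `η₀²` -/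

section Derivatives

theorem deriv_div_sq {f g : ℝ → ℝ} {x : ℝ} (hf : DifferentiableAt ℝ f x)
    (hg : DifferentiableAt ℝ g x) (h0 : g x ≠ 0) :
    deriv (fun s => f s / g s ^ 2) x = (deriv f x * g x - 2 * f x * deriv g x) / g x ^ 3 := by
  have := (hf.hasDerivAt.div (hg.hasDerivAt.pow 2) (pow_ne_zero 2 h0)).deriv
  refine Eq.trans this ?_
  simp only [Pi.pow_apply]
  field_simp
  push_cast
  ring

theorem deriv_mul_exp_neg {f H : ℝ → ℝ} {x : ℝ} (hf : DifferentiableAt ℝ f x)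
    (hH : DifferentiableAt ℝ H x) :
    deriv (fun s => f s * Real.exp (-H s)) x =
      (deriv f x - f x * deriv H x) * Real.exp (-H x) := by
  have := (hf.hasDerivAt.mul hH.hasDerivAt.neg.exp).deriv
  refine Eq.trans this ?_
  simp only [Pi.neg_apply]
  ring

theorem deriv_deriv_mul_exp_neg {f H : ℝ → ℝ} {x : ℝ} (hf : ContDiffAt ℝ 2 f x)
    (hH : ContDiffAt ℝ 2 H x) :
    deriv (deriv (fun s => f s * Real.exp (-H s))) x =
      (deriv (deriv f) x - 2 * deriv f x * deriv H x - f x * deriv (deriv H) x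
        + f x * deriv H x ^ 2) * Real.exp (-H x) := by
  have e : deriv (fun s => f s * Real.exp (-H s)) =ᶠ[𝓝 x]
      fun s => (deriv f s - f s * deriv H s) * Real.exp (-H s) := by
    filter_upwards [eventually_differentiableAt hf, eventually_differentiableAt hH] with s h1 h2
      using deriv_mul_exp_neg h1 h2
  have df := hf.differentiableAt (by simp)
  have dH := hH.differentiableAt (by simp)
  have ddf := differentiableAt_deriv hf
  have ddH := differentiableAt_deriv hH
  rw [e.deriv_eq, deriv_mul_exp_neg (ddf.fun_sub (df.fun_mul ddH)) dH,
    deriv_fun_sub ddf (df.fun_mul ddH), deriv_fun_mul df ddH]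
  ring

/-- With h = σ₀ along a line of constant z this is the exponent H in η₀² = exp H. -/
theorem deriv_four_mul_log {h : ℝ → ℝ} {x : ℝ} (hx : 0 < x) (hh : ContDiffAt ℝ 2 h x) :
    ContDiffAt ℝ 2 (fun s => 4 * Real.log s + 2 * h s) x ∧
    deriv (fun s => 4 * Real.log s + 2 * h s) x = 4 / x + 2 * deriv h x ∧
    deriv (deriv (fun s => 4 * Real.log s + 2 * h s)) x =
      -4 / x ^ 2 + 2 * deriv (deriv h) x := by
  have key : ∀ y : ℝ, 0 < y → DifferentiableAt ℝ h y →
      deriv (fun s => 4 * Real.log s + 2 * h s) y = 4 * y⁻¹ + 2 * deriv h y := fun y hy h1 =>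
    (((Real.hasDerivAt_log hy.ne').const_mul 4).add (h1.hasDerivAt.const_mul 2)).deriv
  have e : deriv (fun s => 4 * Real.log s + 2 * h s) =ᶠ[𝓝 x]
      fun s => 4 * s⁻¹ + 2 * deriv h s := by
    filter_upwards [eventually_differentiableAt hh, lt_mem_nhds hx] with s h1 h2
      using key s h2 h1
  refine ⟨(contDiffAt_const.mul (Real.contDiffAt_log.2 hx.ne')).add (contDiffAt_const.mul hh),
    ?_, ?_⟩
  · rw [e.eq_of_nhds]; ring
  · rw [e.deriv_eq]
    have := (((hasDerivAt_inv hx.ne').const_mul 4).add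
      ((differentiableAt_deriv hh).hasDerivAt.const_mul 2)).deriv
    refine Eq.trans this ?_
    ring

variable {m ρ z : ℝ} {w : ℝ → ℝ → ℝ}

theorem contDiffAt_line_rho (hw : ContDiffOn ℝ 2 (fun x : ℝ × ℝ => w x.1 x.2) halfPlane)
    (hρ : 0 < ρ) : ContDiffAt ℝ 2 (fun s => w s z) ρ := by
  have h1 : ContDiffAt ℝ 2 (fun x : ℝ × ℝ => w x.1 x.2) ((fun s : ℝ => (s, z)) ρ) :=
    hw.contDiffAt (isOpen_halfPlane.mem_nhds hρ)
  exact h1.comp ρ (contDiffAt_id.prodMk contDiffAt_const)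

theorem contDiffAt_line_z (hw : ContDiffOn ℝ 2 (fun x : ℝ × ℝ => w x.1 x.2) halfPlane)
    (hρ : 0 < ρ) : ContDiffAt ℝ 2 (fun s => w ρ s) z := by
  have h1 : ContDiffAt ℝ 2 (fun x : ℝ × ℝ => w x.1 x.2) ((fun s : ℝ => (ρ, s)) z) :=
    hw.contDiffAt (isOpen_halfPlane.mem_nhds hρ)
  exact h1.comp z (contDiffAt_const.prodMk contDiffAt_id)

/-- The exponential form makes second derivatives of w / η₀² those of w exp(−H), which involve only
derivatives of w and H. -/
theorem div_eta0_sq_eq (hm : 0 < m) (hρ : 0 < ρ) : w ρ z / eta0 m ρ z ^ 2 =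
    w ρ z * Real.exp (-(4 * Real.log ρ + 2 * sigma0 m ρ z)) := by
  rw [eta0_eq_mul_exp hm hρ, div_eq_mul_inv]
  congr 1
  rw [Real.exp_neg, Real.exp_add, show (4 : ℝ) * Real.log ρ = ((4 : ℕ) : ℝ) * Real.log ρ by norm_num,
    Real.exp_nat_mul, Real.exp_log hρ, two_mul, Real.exp_add]
  congr 1
  ring

/-- The operator `⁷Δ` applied to `w / η₀²`, in terms of the operator of the evolution equation
of the twist potential applied to `w`. -/
theorem lap7_div_eta0_sq (hm : 0 < m) (hρ : 0 < ρ)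
    (hw : ContDiffOn ℝ 2 (fun x : ℝ × ℝ => w x.1 x.2) halfPlane) :
    lap7 (fun a b => w a b / eta0 m a b ^ 2) ρ z =
      (lap3 w ρ z - 4 * (dRho w ρ z / ρ) - 2 * gradDot w (sigma0 m) ρ z) / eta0 m ρ z ^ 2
        - 2 * gradDot (sigma0 m) (fun a b => w a b / eta0 m a b ^ 2) ρ z
        - 2 * (w ρ z / eta0 m ρ z ^ 2) * lap3 (sigma0 m) ρ z := by
  obtain ⟨K3, -, h3⟩ := CoordLine.exists_deriv_sigma0
  have cρ : ContDiffAt ℝ 2 (fun s => sigma0 m s z) ρ := (h3 (coordLine_rho hρ) hm).1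
  have cz : ContDiffAt ℝ 2 (fun s => sigma0 m ρ s) z := (h3 (coordLine_z hρ) hm).1
  have wρ := contDiffAt_line_rho (z := z) hw hρ
  have wz := contDiffAt_line_z (z := z) hw hρ
  obtain ⟨Hρ, Hρ1, Hρ2⟩ := deriv_four_mul_log hρ cρ
  have Hz : ContDiffAt ℝ 2 (fun s => 4 * Real.log ρ + 2 * sigma0 m ρ s) z :=
    contDiffAt_const.add (contDiffAt_const.mul cz)
  have Hz' : deriv (fun s => 4 * Real.log ρ + 2 * sigma0 m ρ s) =
      fun s => 2 * deriv (fun s => sigma0 m ρ s) s := by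
    ext s; rw [deriv_const_add, deriv_const_mul_field]
  have Hz2 : deriv (deriv (fun s => 4 * Real.log ρ + 2 * sigma0 m ρ s)) z =
      2 * deriv (deriv (fun s => sigma0 m ρ s)) z := by
    rw [Hz', deriv_const_mul_field]
  have eρ : (fun s => w s z / eta0 m s z ^ 2) =ᶠ[𝓝 ρ]
      fun s => w s z * Real.exp (-(4 * Real.log s + 2 * sigma0 m s z)) := by
    filter_upwards [lt_mem_nhds hρ] with s hs using div_eta0_sq_eq hm hs
  have ez : (fun s => w ρ s / eta0 m ρ s ^ 2) =
      fun s => w ρ s * Real.exp (-(4 * Real.log ρ + 2 * sigma0 m ρ s)) := by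
    ext s; exact div_eta0_sq_eq hm hρ
  have d1 := deriv_mul_exp_neg (wρ.differentiableAt (by simp)) (Hρ.differentiableAt (by simp))
  have d2 := deriv_deriv_mul_exp_neg wρ Hρ
  have d3 := deriv_mul_exp_neg (wz.differentiableAt (by simp)) (Hz.differentiableAt (by simp))
  have d4 := deriv_deriv_mul_exp_neg wz Hz
  rw [← eρ.deriv_eq] at d1
  rw [← eρ.deriv.deriv_eq] at d2
  rw [← ez] at d3 d4
  rw [Hρ1] at d1
  rw [Hρ1, Hρ2] at d2
  rw [Hz'] at d3
  rw [Hz2, Hz'] at d4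
  have hE : 0 < Real.exp (-(4 * Real.log ρ + 2 * sigma0 m ρ z)) := Real.exp_pos _
  have h0 := div_eta0_sq_eq (z := z) (w := fun _ _ => 1) hm hρ
  simp only [one_mul] at h0
  simp only [lap7, lap3, lap2, gradDot, dRho, dZ]
  rw [d1, d2, d3, d4, ← h0]
  field_simp
  ring

end Derivatives

/-! ### Comparison of extended-valued integrals on the half plane -/

section Integrals

theorem lintegral_halfPlane_le {f g : ℝ → ℝ → ℝ} {c : ℝ} (hc : 0 ≤ c)
    (h : ∀ ρ z, 0 < ρ → f ρ z ≤ c * g ρ z) :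
    ∫⁻ x in halfPlane, ENNReal.ofReal (f x.1 x.2) ≤
      ENNReal.ofReal c * ∫⁻ x in halfPlane, ENNReal.ofReal (g x.1 x.2) := by
  rw [← lintegral_const_mul' _ _ ENNReal.ofReal_ne_top]
  refine setLIntegral_mono' measurableSet_halfPlane fun x hx => ?_
  rw [← ENNReal.ofReal_mul hc]
  exact ENNReal.ofReal_le_ofReal (h x.1 x.2 hx)

/-- Additivity needs measurability of one summand only, here `k`. So `g` is arbitrary, and may be an
energy density of time derivatives, for which no regularity has been established. -/
theorem lintegral_halfPlane_le_add {f g k : ℝ → ℝ → ℝ} {c d : ℝ} (hc : 0 ≤ c) (hd : 0 ≤ d)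
    (hk : ContinuousOn (fun x : ℝ × ℝ => k x.1 x.2) halfPlane)
    (h : ∀ ρ z, 0 < ρ → f ρ z ≤ c * g ρ z + d * k ρ z) :
    ∫⁻ x in halfPlane, ENNReal.ofReal (f x.1 x.2) ≤
      ENNReal.ofReal c * (∫⁻ x in halfPlane, ENNReal.ofReal (g x.1 x.2))
        + ENNReal.ofReal d * ∫⁻ x in halfPlane, ENNReal.ofReal (k x.1 x.2) := by
  rw [← lintegral_const_mul' _ _ ENNReal.ofReal_ne_top,
    ← lintegral_const_mul' _ _ ENNReal.ofReal_ne_top,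
    ← lintegral_add_right' _
      ((hk.aemeasurable measurableSet_halfPlane).ennreal_ofReal.const_mul _)]
  refine setLIntegral_mono' measurableSet_halfPlane fun x hx => ?_
  rw [← ENNReal.ofReal_mul hc, ← ENNReal.ofReal_mul hd]
  exact (ENNReal.ofReal_le_ofReal (h x.1 x.2 hx)).trans ENNReal.ofReal_add_le

theorem ofReal_mul_add_le {a b c d : ℝ} (ha : 0 ≤ a) (hb : 0 ≤ b) (hc : 0 ≤ c) (hd : 0 ≤ d)
    {x y E : ℝ≥0∞} (hx : x ≤ ENNReal.ofReal b * E) (hy : y ≤ ENNReal.ofReal d * E) :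
    ENNReal.ofReal a * x + ENNReal.ofReal c * y ≤ ENNReal.ofReal (a * b + c * d) * E := by
  rw [ENNReal.ofReal_add (by positivity) (by positivity), ENNReal.ofReal_mul ha,
    ENNReal.ofReal_mul hc, add_mul, mul_assoc, mul_assoc]
  gcongr

theorem ofReal_mul_le {a b : ℝ} (ha : 0 ≤ a) {x E : ℝ≥0∞} (hx : x ≤ ENNReal.ofReal b * E) :
    ENNReal.ofReal a * x ≤ ENNReal.ofReal (a * b) * E := by
  rw [ENNReal.ofReal_mul ha, mul_assoc]
  gcongr

end Integrals

/-! ### Coercivity of the energy -/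

section Coercivity

/-- The density, with respect to `ρ dρ dz`, of the weighted norm of `σ` and `w / η₀²`. -/
noncomputable def weightedDensity (m : ℝ) (σ w : ℝ → ℝ → ℝ) (ρ z : ℝ) : ℝ :=
  eta0 m ρ z ^ 2 * gradSq (fun a b => w a b / eta0 m a b ^ 2) ρ z
    + (rad ρ z + m) ^ 4 * sinTheta ρ z ^ 2 * ((w ρ z / eta0 m ρ z ^ 2) ^ 2 / rad ρ z ^ 2)
    + gradSq σ ρ z + σ ρ z ^ 2 / rad ρ z ^ 2

variable {m ρ z : ℝ} {p d χ χ' σ w : ℝ → ℝ → ℝ}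

theorem gradSq_nonneg (f : ℝ → ℝ → ℝ) (ρ z : ℝ) : 0 ≤ gradSq f ρ z := by
  unfold gradSq; positivity

theorem gradDot_sq_le (f g : ℝ → ℝ → ℝ) (ρ z : ℝ) :
    gradDot f g ρ z ^ 2 ≤ gradSq f ρ z * gradSq g ρ z := by
  unfold gradDot gradSq
  nlinarith [sq_nonneg (dRho f ρ z * dZ g ρ z - dZ f ρ z * dRho g ρ z)]

theorem contDiffOn_div_eta0_sq (hm : 0 < m)
    (hw : ContDiffOn ℝ 2 (fun x : ℝ × ℝ => w x.1 x.2) halfPlane) :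
    ContDiffOn ℝ 2 (fun x : ℝ × ℝ => w x.1 x.2 / eta0 m x.1 x.2 ^ 2) halfPlane :=
  hw.div ((contDiffOn_eta0 hm).pow 2) fun _ hx => pow_ne_zero 2 (eta0_pos hm hx).ne'

theorem kinetic_le_energyDensity (hρ : 0 < ρ) :
    (Real.exp (2 * (sigma0 m ρ z + q0 m ρ z)) * p ρ z ^ 2
      + Real.exp (2 * (sigma0 m ρ z + q0 m ρ z)) / eta0 m ρ z ^ 2 * d ρ z ^ 2) * ρ ≤
      1 / 2 * energyDensity m p d χ χ' σ w ρ z := by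
  have hE := Real.exp_pos (2 * (sigma0 m ρ z + q0 m ρ z))
  have hU := Real.exp_pos (-2 * u0 m ρ z)
  unfold energyDensity
  have key : ∀ a b c x y v : ℝ, 0 ≤ c → 0 ≤ x → 0 ≤ y → 0 ≤ v →
      (a + b) * ρ ≤ 1 / 2 * (ρ * (2 * a + 2 * b + c + x + y + v)) := by
    intro a b c x y v hc hx hy hv
    have : 0 ≤ ρ * (c + x + y + v) := by positivity
    linarith
  rw [mul_assoc 2 (Real.exp _), mul_assoc 2 (Real.exp _ / _)]
  exact key _ _ _ _ _ _ (by positivity) (by positivity) (by positivity) (by positivity)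

theorem potential_le_energyDensity (hm : 0 < m) (hρ : 0 < ρ) :
    (((dRho σ ρ z + w ρ z / eta0 m ρ z ^ 2 * dRho (omega0 m) ρ z) ^ 2
      + (dZ σ ρ z + w ρ z / eta0 m ρ z ^ 2 * dZ (omega0 m) ρ z) ^ 2)
    + ((dRho (fun a b => w a b / eta0 m a b) ρ z
          - σ ρ z / eta0 m ρ z * dRho (omega0 m) ρ z) ^ 2
      + (dZ (fun a b => w a b / eta0 m a b) ρ z
          - σ ρ z / eta0 m ρ z * dZ (omega0 m) ρ z) ^ 2)
    + ((σ ρ z / eta0 m ρ z * dRho (omega0 m) ρ z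
          - w ρ z / eta0 m ρ z ^ 2 * dRho (eta0 m) ρ z) ^ 2
      + (σ ρ z / eta0 m ρ z * dZ (omega0 m) ρ z
          - w ρ z / eta0 m ρ z ^ 2 * dZ (eta0 m) ρ z) ^ 2)) * ρ ≤
      energyDensity m p d χ χ' σ w ρ z := by
  have hη := eta0_pos (z := z) hm hρ
  unfold energyDensity
  rw [mul_comm]
  refine mul_le_mul_of_nonneg_left ?_ hρ.le
  have h1 : 0 ≤ 2 * Real.exp (2 * (sigma0 m ρ z + q0 m ρ z)) * p ρ z ^ 2 := by positivity
  have h2 : 0 ≤ 2 * (Real.exp (2 * (sigma0 m ρ z + q0 m ρ z)) / eta0 m ρ z ^ 2) * d ρ z ^ 2 := by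
    positivity
  have h3 : 0 ≤ 4 * Real.exp (-2 * u0 m ρ z) * (2 * (χ ρ z ^ 2 + χ' ρ z ^ 2)) := by positivity
  linarith

/-- The right-hand sides are the components of Y + Z, in which σ has dropped out. -/
theorem eta0_mul_deriv_div_eta0_sq (hm : 0 < m)
    (hw : ContDiffOn ℝ 2 (fun x : ℝ × ℝ => w x.1 x.2) halfPlane) (hρ : 0 < ρ) :
    (eta0 m ρ z * dRho (fun a b => w a b / eta0 m a b ^ 2) ρ z =
      dRho (fun a b => w a b / eta0 m a b) ρ z
        - w ρ z / eta0 m ρ z ^ 2 * dRho (eta0 m) ρ z) ∧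
    (eta0 m ρ z * dZ (fun a b => w a b / eta0 m a b ^ 2) ρ z =
      dZ (fun a b => w a b / eta0 m a b) ρ z
        - w ρ z / eta0 m ρ z ^ 2 * dZ (eta0 m) ρ z) := by
  have hη := eta0_pos (z := z) hm hρ
  have key : ∀ {f g : ℝ → ℝ} {x : ℝ}, ContDiffAt ℝ 2 f x → ContDiffAt ℝ 2 g x → g x ≠ 0 →
      g x * deriv (fun s => f s / g s ^ 2) x
        = deriv (fun s => f s / g s) x - f x / g x ^ 2 * deriv g x := by
    intro f g x hf hg h0
    have hf' := hf.differentiableAt (by simp)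
    have hg' := hg.differentiableAt (by simp)
    rw [deriv_div_sq hf' hg' h0, deriv_fun_div hf' hg' h0]
    field_simp
    ring
  exact ⟨key (contDiffAt_line_rho hw hρ) (contDiffAt_line_rho (contDiffOn_eta0 hm) hρ) hη.ne',
    key (contDiffAt_line_z hw hρ) (contDiffAt_line_z (contDiffOn_eta0 hm) hρ) hη.ne'⟩

theorem eta0_sq_mul_gradSq_le (hm : 0 < m)
    (hw : ContDiffOn ℝ 2 (fun x : ℝ × ℝ => w x.1 x.2) halfPlane) (hρ : 0 < ρ) :
    eta0 m ρ z ^ 2 * gradSq (fun a b => w a b / eta0 m a b ^ 2) ρ z * ρ ≤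
      2 * energyDensity m p d χ χ' σ w ρ z := by
  have h1 := potential_le_energyDensity (z := z) (p := p) (d := d) (χ := χ) (χ' := χ') (σ := σ)
    (w := w) hm hρ
  obtain ⟨e1, e2⟩ := eta0_mul_deriv_div_eta0_sq (z := z) hm hw hρ
  refine le_trans ?_ (mul_le_mul_of_nonneg_left h1 zero_le_two)
  rw [← mul_assoc]
  refine mul_le_mul_of_nonneg_right ?_ hρ.le
  rw [gradSq, mul_add, ← mul_pow, ← mul_pow, e1, e2]
  set X1 := dRho σ ρ z + w ρ z / eta0 m ρ z ^ 2 * dRho (omega0 m) ρ z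
  set X2 := dZ σ ρ z + w ρ z / eta0 m ρ z ^ 2 * dZ (omega0 m) ρ z
  generalize dRho (fun a b => w a b / eta0 m a b) ρ z = y1
  generalize dZ (fun a b => w a b / eta0 m a b) ρ z = y2
  generalize σ ρ z / eta0 m ρ z * dRho (omega0 m) ρ z = s1
  generalize σ ρ z / eta0 m ρ z * dZ (omega0 m) ρ z = s2
  generalize w ρ z / eta0 m ρ z ^ 2 * dRho (eta0 m) ρ z = n1
  generalize w ρ z / eta0 m ρ z ^ 2 * dZ (eta0 m) ρ z = n2
  -- Here y − n = (y − s) + (s − n) in each component, and (u + v)² ≤ 2u² + 2v².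
  nlinarith [sq_nonneg X1, sq_nonneg X2, sq_nonneg (y1 - s1 - (s1 - n1)),
    sq_nonneg (y2 - s2 - (s2 - n2))]

/-- From ∂σ = X − b ∂ω₀, with |∂ω₀|² r² ≤ A η₀² ≤ 16 A (r + m)⁴ sin⁴θ. The constant 32 is 2 · 16,
and sin⁴θ is relaxed to sin²θ. -/
theorem gradSq_mul_le {A : ℝ} (hA : 0 ≤ A) (hm : 0 < m) (hρ : 0 < ρ)
    (hω : gradSq (omega0 m) ρ z * rad ρ z ^ 2 ≤ A * eta0 m ρ z ^ 2) :
    gradSq σ ρ z * ρ ≤ 2 * energyDensity m p d χ χ' σ w ρ z + 32 * A *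
      ((rad ρ z + m) ^ 4 * sinTheta ρ z ^ 2 * ((w ρ z / eta0 m ρ z ^ 2) ^ 2 / rad ρ z ^ 2) * ρ) := by
  have h1 := potential_le_energyDensity (z := z) (p := p) (d := d) (χ := χ) (χ' := χ') (σ := σ)
    (w := w) hm hρ
  have hr := rad_pos (z := z) hρ
  have hs := sinTheta_pos (z := z) hρ
  have hs1 := sinTheta_le_one (z := z) hρ
  have hη := eta0_pos (z := z) hm hρ
  have hηle := eta0_le (z := z) hm hρ
  set b := w ρ z / eta0 m ρ z ^ 2
  have h2 : b ^ 2 * gradSq (omega0 m) ρ z ≤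
      16 * A * ((rad ρ z + m) ^ 4 * sinTheta ρ z ^ 2 * (b ^ 2 / rad ρ z ^ 2)) := by
    have hs4 : sinTheta ρ z ^ 4 ≤ sinTheta ρ z ^ 2 := pow_le_pow_of_le_one hs.le hs1 (by norm_num)
    calc b ^ 2 * gradSq (omega0 m) ρ z
        = b ^ 2 / rad ρ z ^ 2 * (gradSq (omega0 m) ρ z * rad ρ z ^ 2) := by field_simp
      _ ≤ b ^ 2 / rad ρ z ^ 2 * (A * (4 * ((rad ρ z + m) ^ 2 * sinTheta ρ z ^ 2)) ^ 2) := by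
          refine mul_le_mul_of_nonneg_left (hω.trans ?_) (by positivity)
          gcongr
      _ = 16 * A * ((rad ρ z + m) ^ 4 * sinTheta ρ z ^ 4 * (b ^ 2 / rad ρ z ^ 2)) := by ring
      _ ≤ _ := by gcongr
  -- Componentwise, 2(a + v)² + 2v² − a² = (a + 2v)².
  have h3 : gradSq σ ρ z ≤ 2 * ((dRho σ ρ z + b * dRho (omega0 m) ρ z) ^ 2
      + (dZ σ ρ z + b * dZ (omega0 m) ρ z) ^ 2) + 2 * (b ^ 2 * gradSq (omega0 m) ρ z) := by
    unfold gradSq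
    nlinarith [sq_nonneg (dRho σ ρ z + 2 * (b * dRho (omega0 m) ρ z)),
      sq_nonneg (dZ σ ρ z + 2 * (b * dZ (omega0 m) ρ z))]
  have h4 := mul_le_mul_of_nonneg_right h3 hρ.le
  have h5 := mul_le_mul_of_nonneg_right h2 hρ.le
  refine h4.trans ?_
  refine le_trans ?_ (add_le_add_left (mul_le_mul_of_nonneg_left h1 zero_le_two) _)
  have h6 : 0 ≤ ((dRho (fun a b => w a b / eta0 m a b) ρ z
          - σ ρ z / eta0 m ρ z * dRho (omega0 m) ρ z) ^ 2
      + (dZ (fun a b => w a b / eta0 m a b) ρ z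
          - σ ρ z / eta0 m ρ z * dZ (omega0 m) ρ z) ^ 2
    + ((σ ρ z / eta0 m ρ z * dRho (omega0 m) ρ z
          - b * dRho (eta0 m) ρ z) ^ 2
      + (σ ρ z / eta0 m ρ z * dZ (omega0 m) ρ z
          - b * dZ (eta0 m) ρ z) ^ 2)) * ρ := by positivity
  linarith

theorem continuousOn_eta0_sq_mul_gradSq (hm : 0 < m)
    (hw : ContDiffOn ℝ 2 (fun x : ℝ × ℝ => w x.1 x.2) halfPlane) :
    ContinuousOn (fun x : ℝ × ℝ => eta0 m x.1 x.2 ^ 2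
      * gradSq (fun a b => w a b / eta0 m a b ^ 2) x.1 x.2 * x.1) halfPlane :=
  (((contDiffOn_eta0 hm).continuousOn.pow 2).mul
    (continuousOn_gradSq (contDiffOn_div_eta0_sq hm hw))).mul continuousOn_fst

theorem continuousOn_weightedDensity (hm : 0 < m)
    (hσ : ContDiffOn ℝ 2 (fun x : ℝ × ℝ => σ x.1 x.2) halfPlane)
    (hw : ContDiffOn ℝ 2 (fun x : ℝ × ℝ => w x.1 x.2) halfPlane) :
    ContinuousOn (fun x : ℝ × ℝ => weightedDensity m σ w x.1 x.2 * x.1) halfPlane := by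
  have h2 := continuousOn_hardy_left (m := m) (g := fun a b => w a b / eta0 m a b ^ 2) 4 2
    (contDiffOn_div_eta0_sq hm hw)
  have h4 := continuousOn_hardy_left (m := m) 0 0 hσ
  simp only [pow_zero, one_mul] at h4
  refine ((((continuousOn_eta0_sq_mul_gradSq hm hw).add h2).add
    ((continuousOn_gradSq hσ).mul continuousOn_fst)).add h4).congr fun x _ => ?_
  simp only [weightedDensity, Pi.add_apply, Pi.mul_apply]
  ring

/-- Coercivity of the energy: it controls the weighted norm of `σ` and `w / η₀²`. -/
theorem exists_coercivity : ∃ C : ℝ, 0 < C ∧ ∀ {m : ℝ} {p d χ χ' σ w : ℝ → ℝ → ℝ}, 0 < m →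
    ContDiffOn ℝ 2 (fun x : ℝ × ℝ => σ x.1 x.2) halfPlane →
    ContDiffOn ℝ 2 (fun x : ℝ × ℝ => w x.1 x.2) halfPlane →
    (∀ φ ∈ Ioo (-(Real.pi / 2)) (Real.pi / 2),
      Tendsto (fun r => σ (r * Real.cos φ) (r * Real.sin φ)) atTop (𝓝 0)) →
    (∀ φ ∈ Ioo (-(Real.pi / 2)) (Real.pi / 2),
      Tendsto (fun r => w (r * Real.cos φ) (r * Real.sin φ)
        / eta0 m (r * Real.cos φ) (r * Real.sin φ) ^ 2) atTop (𝓝 0)) →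
    ∫⁻ x in halfPlane, ENNReal.ofReal (weightedDensity m σ w x.1 x.2 * x.1) ≤
      ENNReal.ofReal C *
        ∫⁻ x in halfPlane, ENNReal.ofReal (energyDensity m p d χ χ' σ w x.1 x.2) := by
  obtain ⟨A, hA, hbd⟩ := exists_background_bound
  -- The constant is left in the unevaluated shape in which `j1` and `j2` combine the four bounds: 2
  -- for η₀² |∂b|², 72 for b², 2 + 32 A · 72 for |∂σ|² and four times that for σ²/r².
  refine ⟨1 * (1 * 2 + 1 * 72) + 1 * (1 * (1 * 2 + 32 * A * 72) + 1 * (4 * (2 + 32 * A * 72))),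
    by positivity, fun {m p d χ χ' σ w} hm hσ hw hlσ hlw => ?_⟩
  set b : ℝ → ℝ → ℝ := fun a b => w a b / eta0 m a b ^ 2 with hbdef
  have hb : ContDiffOn ℝ 2 (fun x : ℝ × ℝ => b x.1 x.2) halfPlane := contDiffOn_div_eta0_sq hm hw
  set E := ∫⁻ x in halfPlane, ENNReal.ofReal (energyDensity m p d χ χ' σ w x.1 x.2)
  have i1 : ∫⁻ x in halfPlane, ENNReal.ofReal (eta0 m x.1 x.2 ^ 2 * gradSq b x.1 x.2 * x.1) ≤
      ENNReal.ofReal 2 * E :=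
    lintegral_halfPlane_le (f := fun ρ z => eta0 m ρ z ^ 2 * gradSq b ρ z * ρ)
      (g := energyDensity m p d χ χ' σ w) zero_le_two
      fun ρ z hρ => eta0_sq_mul_gradSq_le hm hw hρ
  have hη4 : ∀ ρ z, 0 < ρ → (rad ρ z + m) ^ 4 * sinTheta ρ z ^ 4 * gradSq b ρ z * ρ ≤
      4 * (eta0 m ρ z ^ 2 * gradSq b ρ z * ρ) := by
    intro ρ z hρ
    have hr := rad_pos (z := z) hρ
    have hg := gradSq_nonneg b ρ z
    have h1 := le_eta0 (z := z) hm hρ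
    calc _ = ((rad ρ z + m) ^ 2 * sinTheta ρ z ^ 2) ^ 2 * gradSq b ρ z * ρ := by ring
      _ ≤ (2 * eta0 m ρ z) ^ 2 * gradSq b ρ z * ρ := by gcongr
      _ = _ := by ring
  have i2 : ∫⁻ x in halfPlane, ENNReal.ofReal
      ((rad x.1 x.2 + m) ^ 4 * sinTheta x.1 x.2 ^ 4 * gradSq b x.1 x.2 * x.1) ≤
      ENNReal.ofReal (4 * 2) * E :=
    (lintegral_halfPlane_le
      (f := fun ρ z => (rad ρ z + m) ^ 4 * sinTheta ρ z ^ 4 * gradSq b ρ z * ρ)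
      (g := fun ρ z => eta0 m ρ z ^ 2 * gradSq b ρ z * ρ) (by norm_num) hη4).trans
      (ofReal_mul_le (by norm_num) i1)
  have i3 : ∫⁻ x in halfPlane, ENNReal.ofReal ((rad x.1 x.2 + m) ^ 4 * sinTheta x.1 x.2 ^ 4
      * (b x.1 x.2 ^ 2 / rad x.1 x.2 ^ 2) * x.1) ≤ ENNReal.ofReal (4 * (4 * 2)) * E :=
    (hardy_halfPlane_radial hm.le 4 4 hb hlw).trans
      ((lintegral_halfPlane_le
        (f := fun ρ z => 4 * ((rad ρ z + m) ^ 4 * sinTheta ρ z ^ 4 * gradSq b ρ z * ρ))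
        (g := fun ρ z => (rad ρ z + m) ^ 4 * sinTheta ρ z ^ 4 * gradSq b ρ z * ρ)
        (c := 4) (by norm_num) fun _ _ _ => le_rfl).trans (ofReal_mul_le (by norm_num) i2))
  -- The angular inequality trades sin⁴θ for sin²θ: 72 = 2 · 32 + 8, from `i3` and `i2`.
  have i4 : ∫⁻ x in halfPlane, ENNReal.ofReal ((rad x.1 x.2 + m) ^ 4 * sinTheta x.1 x.2 ^ 2
      * (b x.1 x.2 ^ 2 / rad x.1 x.2 ^ 2) * x.1) ≤ ENNReal.ofReal 72 * E := by
    refine (hardy_halfPlane_angular hm.le 4 hb).trans ?_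
    refine (lintegral_halfPlane_le_add (c := 2) (d := 1)
      (f := fun ρ z => 2 * ((rad ρ z + m) ^ 4 * sinTheta ρ z ^ 4
          * (b ρ z ^ 2 / rad ρ z ^ 2) * ρ)
        + (rad ρ z + m) ^ 4 * sinTheta ρ z ^ 4 * gradSq b ρ z * ρ)
      (g := fun ρ z => (rad ρ z + m) ^ 4 * sinTheta ρ z ^ 4 * (b ρ z ^ 2 / rad ρ z ^ 2) * ρ)
      (k := fun ρ z => (rad ρ z + m) ^ 4 * sinTheta ρ z ^ 4 * gradSq b ρ z * ρ)
      (by norm_num) (by norm_num) (continuousOn_hardy_right 4 4 hb)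
      fun _ _ _ => by rw [one_mul]).trans ?_
    refine (ofReal_mul_add_le (b := 4 * (4 * 2)) (d := 4 * 2) (by norm_num) (by norm_num)
      (by norm_num) (by norm_num) i3 i2).trans (le_of_eq ?_)
    norm_num
  have i5 : ∫⁻ x in halfPlane, ENNReal.ofReal (gradSq σ x.1 x.2 * x.1) ≤
      ENNReal.ofReal (2 + 32 * A * 72) * E := by
    refine (lintegral_halfPlane_le_add (c := 2) (d := 32 * A)
      (f := fun ρ z => gradSq σ ρ z * ρ) (g := energyDensity m p d χ χ' σ w)
      (k := fun ρ z => (rad ρ z + m) ^ 4 * sinTheta ρ z ^ 2 * (b ρ z ^ 2 / rad ρ z ^ 2) * ρ)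
      (by norm_num) (by positivity) (continuousOn_hardy_left 4 2 hb)
      fun ρ z hρ => gradSq_mul_le hA.le hm hρ (hbd hm hρ).2.1).trans ?_
    refine (ofReal_mul_add_le (b := 1) (d := 72) (by norm_num) (by norm_num) (by positivity) (by norm_num)
      (by rw [ENNReal.ofReal_one, one_mul]) i4).trans (le_of_eq ?_)
    rw [mul_one]
  have i6 : ∫⁻ x in halfPlane, ENNReal.ofReal (σ x.1 x.2 ^ 2 / rad x.1 x.2 ^ 2 * x.1) ≤
      ENNReal.ofReal (4 * (2 + 32 * A * 72)) * E := by
    have h := hardy_halfPlane_radial hm.le 0 0 hσ hlσ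
    simp only [pow_zero, one_mul] at h
    exact h.trans ((lintegral_halfPlane_le (f := fun ρ z => 4 * (gradSq σ ρ z * ρ))
        (g := fun ρ z => gradSq σ ρ z * ρ) (c := 4) (by norm_num) fun _ _ _ => le_rfl).trans
        (ofReal_mul_le (by norm_num) i5))
  have c2 := continuousOn_hardy_left (m := m) 4 2 hb
  have c3 := (continuousOn_gradSq hσ).mul continuousOn_fst
  have c4 := continuousOn_hardy_left (m := m) 0 0 hσ
  simp only [pow_zero, one_mul] at c4
  have j1 := (lintegral_halfPlane_le_add (c := 1) (d := 1)
      (f := fun ρ z => eta0 m ρ z ^ 2 * gradSq b ρ z * ρ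
        + (rad ρ z + m) ^ 4 * sinTheta ρ z ^ 2 * (b ρ z ^ 2 / rad ρ z ^ 2) * ρ)
      (g := fun ρ z => eta0 m ρ z ^ 2 * gradSq b ρ z * ρ)
      (k := fun ρ z => (rad ρ z + m) ^ 4 * sinTheta ρ z ^ 2 * (b ρ z ^ 2 / rad ρ z ^ 2) * ρ)
      (by norm_num) (by norm_num) c2 fun _ _ _ => by rw [one_mul, one_mul]).trans
    (ofReal_mul_add_le (by norm_num) (by norm_num) (by norm_num) (by norm_num) i1 i4)
  have j2 := (lintegral_halfPlane_le_add (c := 1) (d := 1)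
      (f := fun ρ z => gradSq σ ρ z * ρ + σ ρ z ^ 2 / rad ρ z ^ 2 * ρ)
      (g := fun ρ z => gradSq σ ρ z * ρ)
      (k := fun ρ z => σ ρ z ^ 2 / rad ρ z ^ 2 * ρ)
      (by norm_num) (by norm_num) c4 fun _ _ _ => by rw [one_mul, one_mul]).trans
    (ofReal_mul_add_le (by norm_num) (by positivity) (by norm_num) (by positivity) i5 i6)
  refine (lintegral_halfPlane_le_add (c := 1) (d := 1)
      (f := fun ρ z => weightedDensity m σ w ρ z * ρ)
      (g := fun ρ z => eta0 m ρ z ^ 2 * gradSq b ρ z * ρ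
        + (rad ρ z + m) ^ 4 * sinTheta ρ z ^ 2 * (b ρ z ^ 2 / rad ρ z ^ 2) * ρ)
      (k := fun ρ z => gradSq σ ρ z * ρ + σ ρ z ^ 2 / rad ρ z ^ 2 * ρ)
      (by norm_num) (by norm_num) (c3.add c4) fun ρ z _ => ?_).trans
    ((ofReal_mul_add_le (by norm_num) (by positivity) (by norm_num) (by positivity) j1
      j2).trans ?_)
  · refine le_of_eq ?_
    simp only [weightedDensity, hbdef]
    ring
  · gcongr
    linarith

end Coercivity

/-! ### Pointwise bounds for the Laplacians from the evolution equations -/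

section SecondOrder

variable {m ρ z : ℝ} {σ w : ℝ → ℝ → ℝ}

/-- The product rule for w = η₀² b: the weighted norm controls ∂b and b, so ∂w must be expressed
through them. -/
theorem gradDot_eq_of_div_eta0_sq (f : ℝ → ℝ → ℝ) (hm : 0 < m) (hρ : 0 < ρ)
    (hw : ContDiffOn ℝ 2 (fun x : ℝ × ℝ => w x.1 x.2) halfPlane) :
    gradDot w f ρ z = eta0 m ρ z ^ 2 * gradDot (fun a b => w a b / eta0 m a b ^ 2) f ρ z
      + 2 * eta0 m ρ z * (w ρ z / eta0 m ρ z ^ 2) * gradDot (eta0 m) f ρ z := by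
  have hη := eta0_pos (z := z) hm hρ
  have wρ := (contDiffAt_line_rho (z := z) hw hρ).differentiableAt (by simp)
  have wz := (contDiffAt_line_z (z := z) hw hρ).differentiableAt (by simp)
  have ηρ := (contDiffAt_line_rho (z := z) (contDiffOn_eta0 hm) hρ).differentiableAt (by simp)
  have ηz := (contDiffAt_line_z (z := z) (contDiffOn_eta0 hm) hρ).differentiableAt (by simp)
  have d1 : dRho (fun a b => w a b / eta0 m a b ^ 2) ρ z = _ := deriv_div_sq wρ ηρ hη.ne'
  have d2 : dZ (fun a b => w a b / eta0 m a b ^ 2) ρ z = _ := deriv_div_sq wz ηz hη.ne'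
  change _ = (dRho w ρ z * eta0 m ρ z - 2 * w ρ z * dRho (eta0 m) ρ z) / _ at d1
  change _ = (dZ w ρ z * eta0 m ρ z - 2 * w ρ z * dZ (eta0 m) ρ z) / _ at d2
  simp only [gradDot]
  rw [d1, d2]
  field_simp
  ring

theorem sq_add_four_le (a b c d : ℝ) :
    (a + b + c + d) ^ 2 ≤ 4 * (a ^ 2 + b ^ 2 + c ^ 2 + d ^ 2) := by
  nlinarith [sq_nonneg (a - b), sq_nonneg (a - c), sq_nonneg (a - d), sq_nonneg (b - c),
    sq_nonneg (b - d), sq_nonneg (c - d)]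

/-- The solutions of the evolution equations control the Laplacians pointwise: `e` stands for
`exp (2 (σ₀ + q₀))`, and `P`, `D` for the time derivatives of `p` and `d`. -/
theorem laplacian_sq_le {A e T P D : ℝ} (hA : 0 ≤ A) (hm : 0 < m) (hρ : 0 < ρ)
    (hw : ContDiffOn ℝ 2 (fun x : ℝ × ℝ => w x.1 x.2) halfPlane)
    (hη : gradSq (eta0 m) ρ z * rad ρ z ^ 2 ≤ A * ((rad ρ z + m) ^ 4 * sinTheta ρ z ^ 2))
    (hω : gradSq (omega0 m) ρ z * rad ρ z ^ 2 ≤ A * eta0 m ρ z ^ 2)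
    (hσ : gradSq (sigma0 m) ρ z * rad ρ z ^ 2 ≤ A)
    (hl : sinTheta ρ z ^ 2 * lap3 (sigma0 m) ρ z ^ 2 * rad ρ z ^ 4 ≤ A)
    (hT0 : 0 ≤ T) (heT : e * T = 1) (hT : T * m ^ 2 ≤ rad ρ z ^ 2)
    (hevσ : -e * P + lap3 σ ρ z = 2 / eta0 m ρ z ^ 2
        * (σ ρ z * gradSq (omega0 m) ρ z - gradDot w (omega0 m) ρ z))
    (hevω : -e * D + lap3 w ρ z = 4 * (dRho w ρ z / ρ) + 2 * gradDot w (sigma0 m) ρ z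
        + 2 * gradDot (omega0 m) σ ρ z) :
    (lap3 σ ρ z ^ 2
      + eta0 m ρ z ^ 2 * lap7 (fun a b => w a b / eta0 m a b ^ 2) ρ z ^ 2) * T ≤
      4 * (e * P ^ 2 + e / eta0 m ρ z ^ 2 * D ^ 2)
        + (400 * (A + A ^ 2) / m ^ 2) * weightedDensity m σ w ρ z := by
  have hr := rad_pos (z := z) hρ
  have hs := sinTheta_pos (z := z) hρ
  have hη0 := eta0_pos (z := z) hm hρ
  have hηle := eta0_le (z := z) hm hρ
  have l7 := lap7_div_eta0_sq (z := z) hm hρ hw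
  have eg := gradDot_eq_of_div_eta0_sq (z := z) (omega0 m) hm hρ hw
  have q1 := gradDot_sq_le (fun a b => w a b / eta0 m a b ^ 2) (omega0 m) ρ z
  have q2 := gradDot_sq_le (eta0 m) (omega0 m) ρ z
  have q3 := gradDot_sq_le (omega0 m) σ ρ z
  have q4 := gradDot_sq_le (sigma0 m) (fun a b => w a b / eta0 m a b ^ 2) ρ z
  have n1 := gradSq_nonneg (eta0 m) ρ z
  have n2 := gradSq_nonneg (omega0 m) ρ z
  have n3 := gradSq_nonneg (sigma0 m) ρ z
  have n4 := gradSq_nonneg σ ρ z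
  have n5 := gradSq_nonneg (fun a b => w a b / eta0 m a b ^ 2) ρ z
  have l3 : lap3 σ ρ z = e * P + 2 / eta0 m ρ z ^ 2
        * (σ ρ z * gradSq (omega0 m) ρ z - gradDot w (omega0 m) ρ z) := by linarith
  have l3' : lap3 w ρ z - 4 * (dRho w ρ z / ρ) - 2 * gradDot w (sigma0 m) ρ z
      = e * D + 2 * gradDot (omega0 m) σ ρ z := by linarith
  rw [l3'] at l7
  rw [eg] at l3
  rw [weightedDensity]
  generalize gradDot (fun a b => w a b / eta0 m a b ^ 2) (omega0 m) ρ z = g1 at *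
  generalize gradDot (eta0 m) (omega0 m) ρ z = g2 at *
  generalize gradDot (omega0 m) σ ρ z = g3 at *
  generalize gradDot (sigma0 m) (fun a b => w a b / eta0 m a b ^ 2) ρ z = g4 at *
  generalize gradSq (fun a b => w a b / eta0 m a b ^ 2) ρ z = Gb at *
  generalize gradSq (eta0 m) ρ z = Gη at *
  generalize gradSq (omega0 m) ρ z = Gω at *
  generalize gradSq (sigma0 m) ρ z = Gσ₀ at *
  generalize gradSq σ ρ z = Gσ at *
  rw [l3, l7]
  generalize w ρ z / eta0 m ρ z ^ 2 = b at *
  generalize lap3 (sigma0 m) ρ z = l at *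
  generalize σ ρ z = s at *
  generalize eta0 m ρ z = η at *
  generalize sinTheta ρ z = S at *
  generalize rad ρ z = r at *
  clear l3 l3' l7 eg hevσ hevω hw
  have hω' : Gω ≤ A * η ^ 2 / r ^ 2 := by rwa [le_div_iff₀ (by positivity)]
  have hη' : Gη ≤ A * ((r + m) ^ 4 * S ^ 2) / r ^ 2 := by rwa [le_div_iff₀ (by positivity)]
  have hσ' : Gσ₀ ≤ A / r ^ 2 := by rwa [le_div_iff₀ (by positivity)]
  have hT' : T ≤ r ^ 2 / m ^ 2 := by rwa [le_div_iff₀ (by positivity)]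
  -- The estimates `t1` to `t6` treat the lower-order terms one by one. In each, the powers of η
  -- from the background bounds cancel and T ≤ r²/m² removes the surplus factor 1/r², leaving a term
  -- of `weightedDensity`.
  have t1 : s ^ 2 * Gω ^ 2 / η ^ 4 * T ≤ A ^ 2 / m ^ 2 * (s ^ 2 / r ^ 2) := by
    calc s ^ 2 * Gω ^ 2 / η ^ 4 * T
        ≤ s ^ 2 * (A * η ^ 2 / r ^ 2) ^ 2 / η ^ 4 * (r ^ 2 / m ^ 2) := by gcongr
      _ = _ := by field_simp
  have t2 : g1 ^ 2 * T ≤ A / m ^ 2 * (η ^ 2 * Gb) := by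
    calc g1 ^ 2 * T ≤ (Gb * (A * η ^ 2 / r ^ 2)) * (r ^ 2 / m ^ 2) := by
          gcongr; exact q1.trans (by gcongr)
      _ = _ := by field_simp
  have t3 : b ^ 2 * g2 ^ 2 / η ^ 2 * T ≤
      A ^ 2 / m ^ 2 * ((r + m) ^ 4 * S ^ 2 * (b ^ 2 / r ^ 2)) := by
    calc b ^ 2 * g2 ^ 2 / η ^ 2 * T
        ≤ b ^ 2 * ((A * ((r + m) ^ 4 * S ^ 2) / r ^ 2) * (A * η ^ 2 / r ^ 2)) / η ^ 2
          * (r ^ 2 / m ^ 2) := by gcongr; exact q2.trans (by gcongr)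
      _ = _ := by field_simp
  have t4 : g3 ^ 2 / η ^ 2 * T ≤ A / m ^ 2 * Gσ := by
    calc g3 ^ 2 / η ^ 2 * T ≤ ((A * η ^ 2 / r ^ 2) * Gσ) / η ^ 2 * (r ^ 2 / m ^ 2) := by
          gcongr; exact q3.trans (by gcongr)
      _ = _ := by field_simp
  have t5 : η ^ 2 * g4 ^ 2 * T ≤ A / m ^ 2 * (η ^ 2 * Gb) := by
    calc η ^ 2 * g4 ^ 2 * T ≤ η ^ 2 * (A / r ^ 2 * Gb) * (r ^ 2 / m ^ 2) := by
          gcongr; exact q4.trans (by gcongr)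
      _ = _ := by field_simp
  -- η² provides sin⁴θ; one sin²θ compensates the 1/ρ in ³Δσ₀, and the other is the weight of b²
  -- gained from the angular Hardy inequality.
  have t6 : η ^ 2 * b ^ 2 * l ^ 2 * T ≤
      16 * A / m ^ 2 * ((r + m) ^ 4 * S ^ 2 * (b ^ 2 / r ^ 2)) := by
    calc η ^ 2 * b ^ 2 * l ^ 2 * T
        ≤ (4 * ((r + m) ^ 2 * S ^ 2)) ^ 2 * b ^ 2 * l ^ 2 * (r ^ 2 / m ^ 2) := by gcongr
      _ = 16 / m ^ 2 * ((r + m) ^ 4 * S ^ 2 * (b ^ 2 / r ^ 2)) * (S ^ 2 * l ^ 2 * r ^ 4) := by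
          field_simp; ring
      _ ≤ 16 / m ^ 2 * ((r + m) ^ 4 * S ^ 2 * (b ^ 2 / r ^ 2)) * A := by gcongr
      _ = _ := by ring
  -- Since e T = 1, the weight turns the square of e P into e P², the density of the kinetic energy.
  have u1 : (e * P + 2 / η ^ 2 * (s * Gω - (η ^ 2 * g1 + 2 * η * b * g2))) ^ 2 * T ≤
      4 * (e * P ^ 2) + 16 * (s ^ 2 * Gω ^ 2 / η ^ 4 * T) + 16 * (g1 ^ 2 * T)
        + 64 * (b ^ 2 * g2 ^ 2 / η ^ 2 * T) := by
    have := mul_le_mul_of_nonneg_right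
      (sq_add_four_le (e * P) (2 * (s * Gω) / η ^ 2) (-(2 * g1)) (-(4 * (b * g2) / η))) hT0
    calc _ = (e * P + 2 * (s * Gω) / η ^ 2 + -(2 * g1) + -(4 * (b * g2) / η)) ^ 2 * T := by
          field_simp; ring
      _ ≤ _ := this
      _ = 4 * (e * (e * T) * P ^ 2) + 16 * (s ^ 2 * Gω ^ 2 / η ^ 4 * T) + 16 * (g1 ^ 2 * T)
        + 64 * (b ^ 2 * g2 ^ 2 / η ^ 2 * T) := by field_simp; ring
      _ = _ := by rw [heT, mul_one]
  have u2 : η ^ 2 * ((e * D + 2 * g3) / η ^ 2 - 2 * g4 - 2 * b * l) ^ 2 * T ≤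
      4 * (e / η ^ 2 * D ^ 2) + 16 * (g3 ^ 2 / η ^ 2 * T) + 16 * (η ^ 2 * g4 ^ 2 * T)
        + 16 * (η ^ 2 * b ^ 2 * l ^ 2 * T) := by
    have := mul_le_mul_of_nonneg_right (mul_le_mul_of_nonneg_left
      (sq_add_four_le (e * D / η ^ 2) (2 * g3 / η ^ 2) (-(2 * g4)) (-(2 * b * l)))
        (sq_nonneg η)) hT0
    calc _ = η ^ 2 * (e * D / η ^ 2 + 2 * g3 / η ^ 2 + -(2 * g4) + -(2 * b * l)) ^ 2 * T := by
          ring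
      _ ≤ _ := this
      _ = 4 * (e * (e * T) / η ^ 2 * D ^ 2) + 16 * (g3 ^ 2 / η ^ 2 * T)
        + 16 * (η ^ 2 * g4 ^ 2 * T) + 16 * (η ^ 2 * b ^ 2 * l ^ 2 * T) := by field_simp; ring
      _ = _ := by rw [heT, mul_one]
  have v1 : 0 ≤ η ^ 2 * Gb := by positivity
  have v2 : 0 ≤ (r + m) ^ 4 * S ^ 2 * (b ^ 2 / r ^ 2) := by positivity
  have v3 : 0 ≤ s ^ 2 / r ^ 2 := by positivity
  generalize η ^ 2 * Gb = V1 at *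
  generalize (r + m) ^ 4 * S ^ 2 * (b ^ 2 / r ^ 2) = V2 at *
  generalize s ^ 2 / r ^ 2 = V3 at *
  have k1 : 0 ≤ A / m ^ 2 := by positivity
  have k2 : 0 ≤ A ^ 2 / m ^ 2 := by positivity
  have c1 : 400 * (A + A ^ 2) / m ^ 2 = 400 * (A / m ^ 2) + 400 * (A ^ 2 / m ^ 2) := by ring
  have c2 : 16 * A / m ^ 2 = 16 * (A / m ^ 2) := by ring
  rw [c1]
  rw [c2] at t6
  generalize A / m ^ 2 = a1 at *
  generalize A ^ 2 / m ^ 2 = a2 at *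
  have x1 := mul_nonneg k1 v1
  have x2 := mul_nonneg k1 v2
  have x3 := mul_nonneg k1 v3
  have x4 := mul_nonneg k1 n4
  have x5 := mul_nonneg k2 v1
  have x6 := mul_nonneg k2 v2
  have x7 := mul_nonneg k2 v3
  have x8 := mul_nonneg k2 n4
  rw [add_mul]
  -- The largest coefficient collected is 16 · 16 = 256, from `t6`; 400 leaves room.
  refine (add_le_add u1 u2).trans ?_
  linarith

end SecondOrder

/-! ### Decay along rays -/

section Falloff

theorem tendsto_polar_cocompact {φ : ℝ} (hφ : φ ∈ Ioo (-(Real.pi / 2)) (Real.pi / 2)) :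
    Tendsto (fun r : ℝ => (r * Real.cos φ, r * Real.sin φ)) atTop
      (cocompact (ℝ × ℝ) ⊓ 𝓟 halfPlane) := by
  have hc : 0 < Real.cos φ := Real.cos_pos_of_mem_Ioo hφ
  refine tendsto_inf.2 ⟨?_, tendsto_principal.2 ?_⟩
  · rw [← Metric.cobounded_eq_cocompact, ← tendsto_norm_atTop_iff_cobounded]
    refine tendsto_atTop_mono (fun r => ?_) (tendsto_id.atTop_mul_const hc)
    exact (le_abs_self _).trans (le_max_left _ _)
  · filter_upwards [eventually_gt_atTop 0] with r hr using mul_pos hr hc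

/-- On a fixed ray 4 η₀² ≥ m² r² cos⁴φ, so ω = o(r²) suffices. The rate degenerates at the axis, but
the radial Hardy inequality is applied ray by ray and needs no uniformity. -/
theorem tendsto_div_eta0_sq_polar {m : ℝ} (hm : 0 < m) {w : ℝ → ℝ → ℝ}
    (hw : Tendsto (fun x : ℝ × ℝ => w x.1 x.2 / rad x.1 x.2 ^ 2)
      (cocompact (ℝ × ℝ) ⊓ 𝓟 halfPlane) (𝓝 0))
    {φ : ℝ} (hφ : φ ∈ Ioo (-(Real.pi / 2)) (Real.pi / 2)) :
    Tendsto (fun r => w (r * Real.cos φ) (r * Real.sin φ)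
        / eta0 m (r * Real.cos φ) (r * Real.sin φ) ^ 2) atTop (𝓝 0) := by
  have hc : 0 < Real.cos φ := Real.cos_pos_of_mem_Ioo hφ
  have h1 := ((hw.comp (tendsto_polar_cocompact hφ)).abs).mul_const
    (4 / (m ^ 2 * Real.cos φ ^ 4))
  rw [abs_zero, zero_mul] at h1
  refine squeeze_zero_norm' ?_ h1
  filter_upwards [eventually_gt_atTop 0] with r hr
  have hρ : 0 < r * Real.cos φ := mul_pos hr hc
  have hη := eta0_pos (z := r * Real.sin φ) hm hρ
  have hle := le_eta0 (z := r * Real.sin φ) hm hρ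
  rw [rad_polar hr.le, sinTheta_polar hr] at hle
  simp only [Function.comp_apply, Real.norm_eq_abs, rad_polar hr.le]
  rw [abs_div, abs_div, abs_of_pos (pow_pos hη 2), abs_of_pos (pow_pos hr 2), div_mul_div_comm,
    div_le_div_iff₀ (pow_pos hη 2) (by positivity)]
  have h2 : r ^ 2 * (m ^ 2 * Real.cos φ ^ 4)
      ≤ 4 * eta0 m (r * Real.cos φ) (r * Real.sin φ) ^ 2 := by
    calc r ^ 2 * (m ^ 2 * Real.cos φ ^ 4)
        ≤ (r + m) ^ 2 * ((r + m) ^ 2 * Real.cos φ ^ 4) := by gcongr <;> linarith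
      _ = ((r + m) ^ 2 * Real.cos φ ^ 2) ^ 2 := by ring
      _ ≤ (2 * eta0 m (r * Real.cos φ) (r * Real.sin φ)) ^ 2 := by gcongr
      _ = _ := by ring
  have := mul_le_mul_of_nonneg_left h2 (abs_nonneg (w (r * Real.cos φ) (r * Real.sin φ)))
  linarith

end Falloff

theorem contDiffOn_slice {f : ℝ → ℝ → ℝ → ℝ} {I : Set ℝ} {t : ℝ} (ht : t ∈ I)
    (hf : ContDiffOn ℝ 2 (fun x : ℝ × ℝ × ℝ => f x.1 x.2.1 x.2.2) (I ×ˢ halfPlane)) :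
    ContDiffOn ℝ 2 (fun x : ℝ × ℝ => f t x.1 x.2) halfPlane :=
  hf.comp (contDiffOn_const.prodMk contDiffOn_id) fun _ hx => ⟨ht, hx⟩

end ExtremeKerr

/-! ### The two mass estimates -/

open ExtremeKerr in
theorem theorem1 (m₀ : ℝ) (hm₀ : 0 < m₀) :
    ∃ C : ℝ, 0 < C ∧
      ∀ (I : Set ℝ) (P : ExtremeKerr.Perturbation), ExtremeKerr.IsLinearPerturbation m₀ I P →
        ∀ t ∈ I,
          ExtremeKerr.firstOrderIntegral m₀ P t ≤ ENNReal.ofReal C * ExtremeKerr.mass2 m₀ P t ∧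
          ExtremeKerr.secondOrderIntegral m₀ P t ≤
            ENNReal.ofReal C * (ExtremeKerr.mass2Bar m₀ P t + ExtremeKerr.mass2 m₀ P t) := by
  obtain ⟨A, hA, hbd⟩ := exists_background_bound
  obtain ⟨C, hC, hcoer⟩ := exists_coercivity
  set K := 400 * (A + A ^ 2) / m₀ ^ 2 with hK
  have hK0 : 0 ≤ K := by positivity
  -- The 16 undoes the normalization of the mass. (1 + A) C serves the first estimate, K C the
  -- lower-order terms of the second, and 2 = 4 · ½ its kinetic terms.
  refine ⟨16 * ((1 + A) * C + K * C + 2), by positivity, fun I P hP t ht => ?_⟩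
  have hσ := contDiffOn_slice ht hP.smooth_σ
  have hω := contDiffOn_slice ht hP.smooth_ω
  set W := ∫⁻ x in halfPlane, ENNReal.ofReal (weightedDensity m₀ (P.σ t) (P.ω t) x.1 x.2 * x.1)
    with hW
  have hmain : W ≤ ENNReal.ofReal C * (16 * mass2 m₀ P t) := by
    rw [mass2, ENNReal.mul_div_cancel (by norm_num) (by norm_num)]
    exact hcoer hm₀ hσ hω (fun φ hφ => (hP.falloff_σ t ht).comp (tendsto_polar_cocompact hφ))
      fun φ hφ => tendsto_div_eta0_sq_polar hm₀ (hP.falloff_ω t ht) hφ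
  have h16 : ∀ c : ℝ, 0 ≤ c → ∀ x : ℝ≥0∞, ENNReal.ofReal c * (16 * x)
      = ENNReal.ofReal (16 * c) * x := by
    intro c hc x
    rw [ENNReal.ofReal_mul (by norm_num), ENNReal.ofReal_ofNat]
    ring
  constructor
  · calc firstOrderIntegral m₀ P t ≤ ENNReal.ofReal (1 + A) * W := by
          refine lintegral_halfPlane_le
            (f := fun ρ z => (1 / 2 * eta0 m₀ ρ z ^ 2 * gradSq (P.omegaBar m₀ t) ρ z
              + gradSq (eta0 m₀) ρ z * P.omegaBar m₀ t ρ z ^ 2 + gradSq (P.σ t) ρ z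
              + P.σ t ρ z ^ 2 / rad ρ z ^ 2) * ρ)
            (g := fun ρ z => weightedDensity m₀ (P.σ t) (P.ω t) ρ z * ρ) (by positivity)
            fun ρ z hρ => ?_
          have hr := rad_pos (z := z) hρ
          rw [← mul_assoc]
          refine mul_le_mul_of_nonneg_right ?_ hρ.le
          change 1 / 2 * eta0 m₀ ρ z ^ 2 * gradSq (fun a b => P.ω t a b / eta0 m₀ a b ^ 2) ρ z
            + gradSq (eta0 m₀) ρ z * (P.ω t ρ z / eta0 m₀ ρ z ^ 2) ^ 2 + gradSq (P.σ t) ρ z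
              + P.σ t ρ z ^ 2 / rad ρ z ^ 2 ≤ _
          rw [weightedDensity]
          have n1 := gradSq_nonneg (fun a b => P.ω t a b / eta0 m₀ a b ^ 2) ρ z
          have n2 := gradSq_nonneg (P.σ t) ρ z
          set b := P.ω t ρ z / eta0 m₀ ρ z ^ 2
          have h1 : gradSq (eta0 m₀) ρ z * b ^ 2 ≤
              A * ((rad ρ z + m₀) ^ 4 * sinTheta ρ z ^ 2 * (b ^ 2 / rad ρ z ^ 2)) := by
            calc _ = gradSq (eta0 m₀) ρ z * rad ρ z ^ 2 * (b ^ 2 / rad ρ z ^ 2) := by field_simp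
              _ ≤ A * ((rad ρ z + m₀) ^ 4 * sinTheta ρ z ^ 2) * (b ^ 2 / rad ρ z ^ 2) := by
                  exact mul_le_mul_of_nonneg_right (hbd hm₀ hρ).1 (by positivity)
              _ = _ := by ring
          have y1 : 0 ≤ eta0 m₀ ρ z ^ 2
            * gradSq (fun a b => P.ω t a b / eta0 m₀ a b ^ 2) ρ z := by positivity
          have y2 : 0 ≤ (rad ρ z + m₀) ^ 4 * sinTheta ρ z ^ 2 * (b ^ 2 / rad ρ z ^ 2) := by
            positivity
          have y3 : 0 ≤ P.σ t ρ z ^ 2 / rad ρ z ^ 2 := by positivity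
          linarith [mul_nonneg hA.le y1, mul_nonneg hA.le n2, mul_nonneg hA.le y3]
      _ ≤ ENNReal.ofReal ((1 + A) * C) * (16 * mass2 m₀ P t) :=
          ofReal_mul_le (by positivity) hmain
      _ ≤ _ := by
          rw [h16 _ (by positivity)]
          gcongr
          linarith [mul_nonneg hK0 hC.le]
  · have hcW := continuousOn_weightedDensity hm₀ hσ hω
    calc secondOrderIntegral m₀ P t ≤ ENNReal.ofReal 2 * (16 * mass2Bar m₀ P t)
          + ENNReal.ofReal K * W := by
          rw [mass2Bar, ENNReal.mul_div_cancel (by norm_num) (by norm_num)]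
          refine lintegral_halfPlane_le_add
            (f := fun ρ z => (lap3 (P.σ t) ρ z ^ 2
              + eta0 m₀ ρ z ^ 2 * lap7 (P.omegaBar m₀ t) ρ z ^ 2)
              * Real.exp (-2 * (q0 m₀ ρ z + sigma0 m₀ ρ z)) * ρ)
            (g := energyDensity m₀ (dot (P.p m₀) t) (dot (P.d m₀) t) (dot (P.chiRhoRho m₀) t)
              (dot (P.chiRhoZ m₀) t) (dot P.σ t) (dot P.ω t))
            (k := fun ρ z => weightedDensity m₀ (P.σ t) (P.ω t) ρ z * ρ)
            (by norm_num) hK0 hcW fun ρ z hρ => ?_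
          obtain ⟨b1, b2, b3, b4⟩ := hbd (z := z) hm₀ hρ
          have h1 := laplacian_sq_le (σ := P.σ t) (w := P.ω t) hA.le hm₀ hρ hω b1 b2 b3 b4
            (Real.exp_pos (-2 * (q0 m₀ ρ z + sigma0 m₀ ρ z))).le
            (e := Real.exp (2 * (sigma0 m₀ ρ z + q0 m₀ ρ z)))
            (by rw [← Real.exp_add, ← Real.exp_zero]; congr 1; ring)
            (exp_neg_two_q0_add_sigma0_le hm₀ hρ) (hP.evolution_σ t ht ρ z hρ)
            (hP.evolution_ω t ht ρ z hρ)
          have h2 := kinetic_le_energyDensity (z := z) (m := m₀) (p := dot (P.p m₀) t)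
            (d := dot (P.d m₀) t) (χ := dot (P.chiRhoRho m₀) t) (χ' := dot (P.chiRhoZ m₀) t)
            (σ := dot P.σ t) (w := dot P.ω t) hρ
          have h3 := mul_le_mul_of_nonneg_right h1 hρ.le
          change (lap3 (P.σ t) ρ z ^ 2 + eta0 m₀ ρ z ^ 2
            * lap7 (fun a b => P.ω t a b / eta0 m₀ a b ^ 2) ρ z ^ 2)
              * Real.exp (-2 * (q0 m₀ ρ z + sigma0 m₀ ρ z)) * ρ ≤ _
          linarith
      _ ≤ ENNReal.ofReal 2 * (16 * mass2Bar m₀ P t)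
          + ENNReal.ofReal (K * C) * (16 * mass2 m₀ P t) := by
          exact add_le_add_right (ofReal_mul_le hK0 hmain) _
      _ ≤ _ := by
          rw [h16 _ (by norm_num), h16 _ (by positivity), mul_add]
          gcongr
          · linarith [mul_nonneg hK0 hC.le, mul_pos (add_pos one_pos hA) hC]
          · linarith [mul_pos (add_pos one_pos hA) hC]
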